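/- Corollary (Gaussian growth). For $f\in L^2(\mathbb{R})$ and $z=x+i\xi\in\mathbb{C}\cong\mathbb{R}^2$, let $\varphi(t)=2^{1/4}e^{-\pi t^2}$ and let $$\mathcal V_\varphi f(z)=\int_{\mathbb R}f(t)\,\varphi(t-x)\,e^{-2\pi i\xi t}\,dt$$ be the Gabor transform of $f$. For a bounded domain $\Omega\subset\mathbb{C}$ let $H_\Omega$ be the time-frequency localization operator on $L^2(\mathbb{R})$, $$H_\Omega f(t)=\int_{\Omega}\mathcal V_\varphi f(z)\,\varphi(t-x)\,e^{2\pi i\xi t}\,dz .$$ An eigenfunction of $H_\Omega$ is a nonzero $f\in L^2(\mathbb{R})$ with $H_\Omega f=\lambda f$ for some $\lambda\in\mathbb{C}$. Let $\Omega\subset\mathbb{C}$ be a bounded, simply connected domain (open set) whose boundary is equal to the boundary of the unbounded connected component of $\mathbb{C}\setminus\overline{\Omega}$ (for instance, the interior of a Jordan curve). (1) If some eigenfunction $f$ of $H_\Omega$ satisfies $\mathcal V_\varphi f(z)=O(e^{-\pi|z|^2/2})$ as $|z|\to\infty$, then $\Omega$ is a disc. (2) If some eigenfunction $f$ of $H_\Omega$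 satisfies $f(t)=O(e^{-\pi t^2})$ as $|t|\to\infty$ and $\hat f(\xi)=O(e^{-\pi\xi^2})$ as $|\xi|\to\infty$ (both for almost every argument), where $\hat f(\xi)=\int_{\mathbb R}f(t)e^{-2\pi i\xi t}\,dt$, then $\Omega$ is a disc. -/

import Mathlib

open MeasureTheory Filter Asymptotics
open scoped FourierTransform Topology

noncomputable section

namespace GaborLocalization

/-- The time-frequency shift `π(z) g (t) = g (t - x) e^{2π i ξ t}`, where the point `(x, ξ)` of the
time-frequency plane is identified with `z = x + i ξ`. -/
def tfShift (z : ℂ) (g : ℝ → ℂ) (t : ℝ) : ℂ :=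
  g (t - z.re) * Complex.exp (2 * Real.pi * Complex.I * z.im * t)

/-- The short-time Fourier (Gabor) transform of `f` with respect to the window `g`,
`V_g f (z) = ∫ f(t) conj(g(t - x)) e^{-2π i ξ t} dt` at `z = x + i ξ`. -/
def stft (g f : ℝ → ℂ) (z : ℂ) : ℂ :=
  ∫ t : ℝ, f t * (starRingEnd ℂ) (g (t - z.re)) *
    Complex.exp (-(2 * Real.pi * Complex.I * z.im * t))

/-- The Gaussian window `φ(t) = 2^{1/4} e^{-π t²}`. -/
def gaussianWindow (t : ℝ) : ℂ :=
  (((2 : ℝ) ^ (1 / 4 : ℝ) * Real.exp (-Real.pi * t ^ 2) : ℝ) : ℂ)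

/-- The time-frequency localization operator with symbol `σ` and window `g`,
`H_{σ,g} f = ∫ σ(z) V_g f(z) π(z)g dz`. For `σ` integrable, `f` square integrable and `g` square
integrable and bounded, the integral converges absolutely for every `t`. -/
def locOpSymbol (σ : ℂ → ℂ) (g f : ℝ → ℂ) (t : ℝ) : ℂ :=
  ∫ z : ℂ, σ z * stft g f z * tfShift z g t

/-- The localization operator `H_Ω`: the symbol is the indicator function of `Ω`, the window is the
Gaussian `φ`. -/
def locOp (Ω : Set ℂ) (f : ℝ → ℂ) : ℝ → ℂ :=
  locOpSymbol (Ω.indicator fun _ => 1) gaussianWindow f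

/-- `f` represents an eigenfunction of `H_Ω` on `L²(ℝ)`. Equality in `L²(ℝ)` is equality almost
everywhere. -/
def IsEigenfunction (Ω : Set ℂ) (f : ℝ → ℂ) : Prop :=
  MemLp f 2 volume ∧ ¬ (f =ᵐ[volume] 0) ∧
    ∃ c : ℂ, locOp Ω f =ᵐ[volume] fun t => c * f t

/-- `h(t) = O(e^{-π t²})` as `|t| → ∞`, for almost every `t`. -/
def HasGaussianDecay (h : ℝ → ℂ) : Prop :=
  h =O[cocompact ℝ ⊓ ae volume] fun t => Real.exp (-Real.pi * t ^ 2)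

/-- The union of the unbounded connected components of the complement of `closure Ω`. For bounded
`Ω ⊆ ℂ` there is exactly one such component. -/
def outerRegion (Ω : Set ℂ) : Set ℂ :=
  {w | w ∈ (closure Ω)ᶜ ∧ ¬ Bornology.IsBounded (connectedComponentIn (closure Ω)ᶜ w)}

end GaborLocalization

end

/-! Either decay condition says that the Bargmann transform of `f` is bounded. For the Gabor
transform this is immediate, since its modulus is that of the Bargmann transform times a Gaussian
(`norm_stft_gaussianWindow`). For decay of `f` and its Fourier transform it is Hardy's uncertainty
principle: the two bounds dominate the transform by `e^{π y²/2}` and `e^{π x²/2}`, and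
Phragmén–Lindelöf gives boundedness. By Liouville the Bargmann transform is constant, so `f` is a
multiple of `e^{-π t²}`.

Inserting a Gaussian into the eigenvalue equation leaves `∫_Ω e^{2π t z - π z²/2 - π|z|²} dz`, which
must not depend on `t`. Its `t`-derivatives at `0` show that the moments of order at least one
vanish (`expMoment_succ_eq_zero`). Expanding `e^{π z²/2} / (w - z)` in powers of `z` turns this into
`∫_Ω z / (w - z) e^{-π|z|²} dz = 0` for large `w` (`integral_div_sub_eq_zero`): from far away, the
Gaussian mass on `Ω` looks like a point mass at `0`.

This is a free boundary problem (`eq_ball_of_integral_eq_zero`). With `m` the Gaussian mass of `Ω`,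
the identity `w * cauchyGauss Ω w = m` continues to the outer region and, by continuity, to its
boundary, which is the boundary of `Ω`. The Cauchy transform of the whole plane is explicit, so the
holomorphic function `w * cauchyGauss Ωᶜ w` on `Ω` has the real boundary values `1 - m -
e^{-π|w|²}`. It is therefore constant, hence `|w|` is constant on the boundary and `Ω` is a disc
centred at `0`. -/

namespace GaborLocalization

/-! ### The Bargmann transform of a square integrable function -/

/-- The integral `∫ f(t) e^{-π t² + 2π s t} dt`, which is the Bargmann transform of `f` up to a
Gaussian factor. -/
noncomputable def gaussLaplace (f : ℝ → ℂ) (s : ℂ) : ℂ :=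
  ∫ t : ℝ, f t * Complex.exp (-Real.pi * t ^ 2 + 2 * Real.pi * s * t)

/-- The (unnormalized) Bargmann transform `e^{-π s² / 2} ∫ f(t) e^{-π t² + 2π s t} dt`. -/
noncomputable def bargmann (f : ℝ → ℂ) (s : ℂ) : ℂ :=
  Complex.exp (-Real.pi * s ^ 2 / 2) * gaussLaplace f s

lemma norm_gaussLaplace_kernel (s : ℂ) (t : ℝ) :
    ‖Complex.exp (-Real.pi * t ^ 2 + 2 * Real.pi * s * t)‖ =
      Real.exp (-Real.pi * t ^ 2 + 2 * Real.pi * s.re * t) := by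
  rw [Complex.norm_exp]
  congr 1
  simp [pow_two]

lemma stft_gaussianWindow_eq (f : ℝ → ℂ) (z : ℂ) :
    stft gaussianWindow f z =
      (((2 : ℝ) ^ (1 / 4 : ℝ) : ℝ) : ℂ) * Complex.exp (-Real.pi * z.re ^ 2) *
        gaussLaplace f ((starRingEnd ℂ) z) := by
  unfold stft gaussLaplace
  rw [← integral_const_mul]
  congr 1
  ext t
  have h2 : (starRingEnd ℂ) z = z.re - Complex.I * z.im := by
    apply Complex.ext <;> simp
  have h1 : (starRingEnd ℂ) (gaussianWindow (t - z.re)) =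
      (((2 : ℝ) ^ (1 / 4 : ℝ) : ℝ) : ℂ) * Complex.exp (-Real.pi * (t - z.re) ^ 2) := by
    rw [gaussianWindow, Complex.conj_ofReal]
    push_cast
    rfl
  have h3 : Complex.exp (-Real.pi * (t - z.re) ^ 2) *
      Complex.exp (-(2 * Real.pi * Complex.I * z.im * t)) =
      Complex.exp (-Real.pi * z.re ^ 2) *
        Complex.exp (-Real.pi * t ^ 2 + 2 * Real.pi * (z.re - Complex.I * z.im) * t) := by
    rw [← Complex.exp_add, ← Complex.exp_add]
    congr 1
    ring
  rw [h1, h2]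
  linear_combination f t * (((2 : ℝ) ^ (1 / 4 : ℝ) : ℝ) : ℂ) * h3

/-- Makes the decay hypothesis on the Gabor transform equivalent to boundedness of the Bargmann
transform near infinity. -/
lemma norm_stft_gaussianWindow (f : ℝ → ℂ) (z : ℂ) :
    ‖stft gaussianWindow f z‖ = (2 : ℝ) ^ (1 / 4 : ℝ) *
      ‖bargmann f ((starRingEnd ℂ) z)‖ * Real.exp (-Real.pi * ‖z‖ ^ 2 / 2) := by
  rw [stft_gaussianWindow_eq, bargmann, norm_mul, norm_mul, norm_mul, Complex.norm_real,
    Real.norm_of_nonneg (by positivity), Complex.norm_exp, Complex.norm_exp]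
  have : Real.exp (-Real.pi * (z.re : ℂ) ^ 2).re =
      Real.exp (-Real.pi * (starRingEnd ℂ) z ^ 2 / 2).re * Real.exp (-Real.pi * ‖z‖ ^ 2 / 2) := by
    rw [← Real.exp_add, Complex.sq_norm, Complex.normSq_apply]
    congr 1
    simp [pow_two]
    ring
  rw [this]
  ring

lemma memLp_exp_neg_mul_sq {b : ℝ} (hb : 0 < b) :
    MemLp (fun t : ℝ => Real.exp (-b * t ^ 2)) 2 volume := by
  rw [memLp_two_iff_integrable_sq (by fun_prop)]
  have := integrable_exp_neg_mul_sq (b := 2 * b) (by positivity)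
  refine this.congr (Eventually.of_forall fun t => ?_)
  simp only
  rw [← Real.exp_nat_mul]
  congr 1
  push_cast
  ring

lemma integrable_norm_mul_gaussian {f : ℝ → ℂ} (hf : MemLp f 2 volume) {b : ℝ} (hb : 0 < b) :
    Integrable (fun t : ℝ => ‖f t‖ * Real.exp (-b * t ^ 2)) :=
  hf.norm.integrable_mul (memLp_exp_neg_mul_sq hb)

/-- A Gaussian of larger width absorbs linear exponentials. -/
lemma exp_neg_sq_add_mul_le (R t : ℝ) :
    Real.exp (-Real.pi * t ^ 2 + R * |t|) ≤
      Real.exp (R ^ 2 / (2 * Real.pi)) * Real.exp (-(Real.pi / 2) * t ^ 2) := by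
  rw [← Real.exp_add]
  apply Real.exp_le_exp.2
  have hpi := Real.pi_pos
  have : R ^ 2 / (2 * Real.pi) + -(Real.pi / 2) * t ^ 2 - (-Real.pi * t ^ 2 + R * |t|)
      = (R - Real.pi * |t|) ^ 2 / (2 * Real.pi) := by
    field_simp
    nlinarith [sq_abs t]
  have h2 : 0 ≤ (R - Real.pi * |t|) ^ 2 / (2 * Real.pi) := by positivity
  linarith

lemma integrable_gaussLaplace {f : ℝ → ℂ} (hf : MemLp f 2 volume) (s : ℂ) :
    Integrable fun t : ℝ =>
      f t * Complex.exp (-Real.pi * t ^ 2 + 2 * Real.pi * s * t) := by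
  refine ((integrable_norm_mul_gaussian hf (b := Real.pi / 2) (by positivity)).const_mul
    (Real.exp ((2 * Real.pi * |s.re|) ^ 2 / (2 * Real.pi)))).mono'
    (hf.1.mul (by fun_prop)) (Eventually.of_forall fun t => ?_)
  rw [norm_mul, norm_gaussLaplace_kernel]
  have h1 : -Real.pi * t ^ 2 + 2 * Real.pi * s.re * t ≤
      -Real.pi * t ^ 2 + (2 * Real.pi * |s.re|) * |t| := by
    have := le_abs_self (s.re * t)
    rw [abs_mul] at this
    nlinarith [Real.pi_pos]
  have h2 := (Real.exp_le_exp.2 h1).trans (exp_neg_sq_add_mul_le _ t)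
  nlinarith [norm_nonneg (f t)]

lemma differentiable_gaussLaplace {f : ℝ → ℂ} (hf : MemLp f 2 volume) :
    Differentiable ℂ (gaussLaplace f) := by
  intro s₀
  -- On the unit ball about `s₀` one has `|Re s| ≤ ‖s₀‖ + 1`; the extra `2π` absorbs the factor `2π
  -- t` produced by differentiation, through `y ≤ e^y`.
  set R : ℝ := 2 * Real.pi * (‖s₀‖ + 1) + 2 * Real.pi with hR
  have key := hasDerivAt_integral_of_dominated_loc_of_deriv_le (μ := (volume : Measure ℝ))
    (F := fun (s : ℂ) (t : ℝ) => f t * Complex.exp (-Real.pi * t ^ 2 + 2 * Real.pi * s * t))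
    (F' := fun (s : ℂ) (t : ℝ) =>
      f t * (Complex.exp (-Real.pi * t ^ 2 + 2 * Real.pi * s * t) * (2 * Real.pi * t)))
    (x₀ := s₀) (s := Metric.ball s₀ 1) (Metric.ball_mem_nhds _ one_pos)
    (bound := fun t => Real.exp (R ^ 2 / (2 * Real.pi)) *
      (‖f t‖ * Real.exp (-(Real.pi / 2) * t ^ 2)))
    (Eventually.of_forall fun s => (integrable_gaussLaplace hf s).1)
    (integrable_gaussLaplace hf s₀) (hf.1.mul (by fun_prop)) ?_
    ((integrable_norm_mul_gaussian hf (by positivity)).const_mul _) ?_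
  · exact key.2.differentiableAt
  · refine Eventually.of_forall fun t s hs => ?_
    rw [norm_mul, norm_mul, norm_gaussLaplace_kernel]
    have hs' : |s.re| ≤ ‖s₀‖ + 1 := by
      have h1 := Complex.abs_re_le_norm s
      have h2 : ‖s - s₀‖ < 1 := by simpa [dist_eq_norm] using hs
      have h3 := norm_le_norm_add_norm_sub s₀ s
      rw [norm_sub_rev] at h2
      linarith [norm_sub_rev s₀ s]
    have h0 : ‖(2 * Real.pi * t : ℂ)‖ = 2 * Real.pi * |t| := by
      simp [abs_of_pos Real.pi_pos]
    have h1 : 2 * Real.pi * |t| ≤ Real.exp (2 * Real.pi * |t|) := by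
      linarith [Real.add_one_le_exp (2 * Real.pi * |t|)]
    have h2 : Real.exp (-Real.pi * t ^ 2 + 2 * Real.pi * s.re * t) * (2 * Real.pi * |t|) ≤
        Real.exp (-Real.pi * t ^ 2 + R * |t|) := by
      have : -Real.pi * t ^ 2 + 2 * Real.pi * s.re * t + 2 * Real.pi * |t| ≤
          -Real.pi * t ^ 2 + R * |t| := by
        have h := le_abs_self (s.re * t)
        rw [abs_mul] at h
        have h' := mul_le_mul_of_nonneg_right hs' (abs_nonneg t)
        rw [hR]
        nlinarith [Real.pi_pos]
      refine le_trans ?_ (Real.exp_le_exp.2 this)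
      rw [Real.exp_add _ (2 * Real.pi * |t|)]
      gcongr
    rw [h0]
    have h3 := h2.trans (exp_neg_sq_add_mul_le R t)
    calc _ ≤ ‖f t‖ * (Real.exp (R ^ 2 / (2 * Real.pi)) * Real.exp (-(Real.pi / 2) * t ^ 2)) := by
          gcongr
      _ = _ := by ring
  · refine Eventually.of_forall fun t s _ => ?_
    have : HasDerivAt (fun s : ℂ => (-Real.pi * t ^ 2 + 2 * Real.pi * s * t : ℂ))
        (2 * Real.pi * t) s := by
      have := (((hasDerivAt_id s).const_mul (2 * Real.pi : ℂ)).mul_const (t : ℂ)).const_add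
        (-Real.pi * (t : ℂ) ^ 2)
      simpa using this
    exact this.cexp.const_mul _

lemma differentiable_bargmann {f : ℝ → ℂ} (hf : MemLp f 2 volume) :
    Differentiable ℂ (bargmann f) := by
  have := differentiable_gaussLaplace hf
  unfold bargmann
  fun_prop

/-! ### Bounded Bargmann transform forces a Gaussian -/

/-- The Fourier transform is injective on integrable functions. -/
lemma ae_eq_zero_of_fourier_eq_zero {g : ℝ → ℂ} (hg : Integrable g) (h : 𝓕 g = 0) :
    g =ᵐ[volume] 0 := by
  apply ae_eq_zero_of_integral_contDiff_smul_eq_zero hg.locallyIntegrable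
  intro u hu hc
  -- The test function is the Fourier transform of a Schwartz function `η`, so the multiplication
  -- formula gives `∫ u g = ∫ η (𝓕 g) = 0`.
  let ψ : SchwartzMap ℝ ℂ := HasCompactSupport.toSchwartzMap
    (f := fun x => (u x : ℂ)) (hc.comp_left (g := fun x : ℝ => (x : ℂ)) rfl)
      (Complex.ofRealCLM.contDiff.comp hu)
  let η : SchwartzMap ℝ ℂ := 𝓕⁻ ψ
  have hη : 𝓕 (η : ℝ → ℂ) = fun x => (u x : ℂ) := by
    have h1 : 𝓕 η = ψ := FourierTransform.fourier_fourierInv_eq ψ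
    have h2 := congrArg (fun k : SchwartzMap ℝ ℂ => (k : ℝ → ℂ)) h1
    simp only [SchwartzMap.fourier_coe] at h2
    rw [h2]
    rfl
  have := VectorFourier.integral_fourierIntegral_smul_eq_flip (L := innerₗ ℝ)
    (μ := volume) (ν := volume) (f := (η : ℝ → ℂ)) (g := g) Real.continuous_fourierChar
      (by simpa using! continuous_inner) η.integrable hg
  simp only [flip_innerₗ] at this
  change ∫ ξ, (𝓕 (η : ℝ → ℂ)) ξ • g ξ = ∫ x, η x • (𝓕 g) x at this
  rw [hη, h] at this
  simpa using this

/-- On the imaginary axis the Bargmann integral is a Fourier transform, so Fourier uniqueness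
recovers `f`. -/
lemma fourier_mul_gaussian (f : ℝ → ℂ) (ξ : ℝ) :
    𝓕 (fun t : ℝ => f t * Complex.exp (-Real.pi * t ^ 2)) ξ =
      gaussLaplace f (-(Complex.I * ξ)) := by
  rw [Real.fourier_eq', gaussLaplace]
  congr 1
  ext t
  rw [smul_eq_mul, mul_left_comm, ← Complex.exp_add]
  congr 2
  simp
  ring

lemma gaussLaplace_gaussian (s : ℂ) :
    gaussLaplace (fun t : ℝ => Complex.exp (-Real.pi * t ^ 2)) s =
      (1 / 2 : ℂ) ^ (1 / 2 : ℂ) * Complex.exp (Real.pi * s ^ 2 / 2) := by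
  have h := integral_cexp_quadratic (b := -(2 * Real.pi)) (by simp [Real.pi_pos])
    (2 * Real.pi * s) 0
  have hpi : (Real.pi : ℂ) ≠ 0 := by exact_mod_cast Real.pi_ne_zero
  have h1 : (Real.pi : ℂ) / -(-(2 * Real.pi)) = 1 / 2 := by field_simp
  have h2 : (0 : ℂ) - (2 * Real.pi * s) ^ 2 / (4 * -(2 * Real.pi)) = Real.pi * s ^ 2 / 2 := by
    field_simp
    ring
  rw [h1, h2] at h
  rw [← h, gaussLaplace]
  congr 1
  ext t
  rw [← Complex.exp_add]
  congr 1
  ring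

lemma memLp_gaussian : MemLp (fun t : ℝ => Complex.exp (-Real.pi * t ^ 2)) 2 volume := by
  have := (memLp_exp_neg_mul_sq Real.pi_pos).ofReal (K := ℂ)
  refine this.congr_norm (by fun_prop) (Eventually.of_forall fun t => ?_)
  congr 1
  simp

/-- Square integrable functions whose Bargmann transform is bounded are Gaussians. -/
lemma exists_ae_eq_gaussian_of_bargmann_bounded {f : ℝ → ℂ} (hf : MemLp f 2 volume) {C : ℝ}
    (hC : ∀ s, ‖bargmann f s‖ ≤ C) :
    ∃ c : ℂ, f =ᵐ[volume] fun t : ℝ => c * Complex.exp (-Real.pi * t ^ 2) := by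
  -- Liouville's theorem.
  obtain ⟨c, hc⟩ := (differentiable_bargmann hf).exists_const_forall_eq_of_bounded
    (isBounded_iff_forall_norm_le.2 ⟨C, by rintro _ ⟨s, rfl⟩; exact hC s⟩)
  have hk : ((1 / 2 : ℂ) ^ (1 / 2 : ℂ)) ≠ 0 := by simp [Complex.cpow_eq_zero_iff]
  set k : ℂ := (1 / 2 : ℂ) ^ (1 / 2 : ℂ)
  have hL : ∀ s, gaussLaplace f s = c * Complex.exp (Real.pi * s ^ 2 / 2) := by
    intro s
    rw [← hc s, bargmann, mul_right_comm, ← Complex.exp_add]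
    ring_nf
    simp
  set γ : ℝ → ℂ := fun t => Complex.exp (-Real.pi * t ^ 2) with hγ
  refine ⟨c / k, ?_⟩
  have hint1 : Integrable fun t : ℝ => f t * γ t := by
    simpa [γ] using integrable_gaussLaplace hf 0
  have hint2 : Integrable fun t : ℝ => γ t * γ t := by
    simpa [γ] using integrable_gaussLaplace memLp_gaussian 0
  -- The Gaussian also has constant Bargmann transform, equal to `k`; the multiple `c / k` matches
  -- the two constants.
  have hF : 𝓕 (fun t => (f t - c / k * γ t) * γ t) = 0 := by
    ext ξ
    have e1 := fourier_mul_gaussian f ξ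
    have e2 := fourier_mul_gaussian γ ξ
    rw [hL, Real.fourier_eq] at e1
    rw [gaussLaplace_gaussian, Real.fourier_eq] at e2
    rw [Real.fourier_eq]
    have i1 := (Real.fourierIntegral_convergent_iff ξ).2 hint1
    have i2 := ((Real.fourierIntegral_convergent_iff ξ).2 hint2).const_mul (c / k)
    have : (fun v => 𝐞 (-inner ℝ v ξ) • ((f v - c / k * γ v) * γ v)) =
        fun v => 𝐞 (-inner ℝ v ξ) • (f v * γ v) - c / k * 𝐞 (-inner ℝ v ξ) • (γ v * γ v) := by
      ext v
      simp only [Circle.smul_def, smul_eq_mul]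
      ring
    rw [this, integral_sub i1 i2, integral_const_mul, e1, e2]
    change c * _ - c / k * (k * _) = 0
    field_simp
    simp
  have hint : Integrable fun t : ℝ => (f t - c / k * γ t) * γ t := by
    have := hint1.sub (hint2.const_mul (c / k))
    refine this.congr (Eventually.of_forall fun t => ?_)
    simp only [Pi.sub_apply]
    ring
  filter_upwards [ae_eq_zero_of_fourier_eq_zero hint hF] with t ht
  have h0 : γ t ≠ 0 := Complex.exp_ne_zero _
  exact sub_eq_zero.1 ((mul_eq_zero.1 ht).resolve_right h0)

/-! ### Phragmén–Lindelöf for functions of order two -/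

/-- Phragmén–Lindelöf in a sector of opening less than `π / 2` for functions of order two. -/
lemma norm_le_on_sector {g : ℂ → ℂ} (hg : Differentiable ℂ g) {A K C θ : ℝ} (hK : 0 ≤ K)
    (hgrow : ∀ z, ‖g z‖ ≤ A * Real.exp (K * ‖z‖ ^ 2)) (hθ0 : 0 < θ) (hθ : θ < Real.pi / 2)
    (h0 : ∀ r : ℝ, 0 < r → ‖g r‖ ≤ C)
    (h1 : ∀ r : ℝ, 0 < r → ‖g (r * Complex.exp (θ * Complex.I))‖ ≤ C)
    {ζ : ℂ} (hζ0 : 0 ≤ ζ.im) (hζ : ζ.im ≤ θ) : ‖g (Complex.exp ζ)‖ ≤ C := by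
  have hd : Differentiable ℂ fun z => g (Complex.exp z) := hg.comp Complex.differentiable_exp
  have split : ∀ z : ℂ, Complex.exp z = (Real.exp z.re : ℝ) * Complex.exp (z.im * Complex.I) := by
    intro z
    rw [Complex.ofReal_exp, ← Complex.exp_add, Complex.re_add_im]
  refine PhragmenLindelof.horizontal_strip (f := fun z => g (Complex.exp z)) (a := 0) (b := θ)
    hd.diffContOnCl ⟨2, ?_, K, ?_⟩ ?_ ?_ hζ0 hζ
  -- In the logarithmic variable the growth is `exp (K e^{2|x|})`, admissible in a strip of width
  -- `θ` because `2 < π / θ`.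
  · rw [sub_zero, lt_div_iff₀ hθ0]
    linarith
  · refine IsBigO.of_bound A (Eventually.of_forall fun z => ?_)
    rw [Real.norm_of_nonneg (Real.exp_pos _).le]
    have hA : 0 ≤ A := by
      have := (norm_nonneg _).trans (hgrow 0)
      simpa using this
    refine (hgrow _).trans ?_
    rw [Complex.norm_exp, ← Real.exp_nat_mul]
    have h2 : ((2 : ℕ) : ℝ) * z.re ≤ 2 * |z.re| := by
      have := le_abs_self z.re
      push_cast
      linarith
    gcongr
  · intro z hz
    have := h0 _ (Real.exp_pos z.re)
    rw [split, hz]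
    simpa using this
  · intro z hz
    rw [split, hz]
    exact h1 _ (Real.exp_pos z.re)

lemma norm_exp_I_mul_sq (a : ℝ) (z : ℂ) :
    ‖Complex.exp (a * Complex.I * z ^ 2)‖ = Real.exp (-(2 * a * (z.re * z.im))) := by
  rw [Complex.norm_exp]
  congr 1
  simp [pow_two]
  ring

/-- A quadrant is the critical opening for order two, so Phragmén–Lindelöf is applied in sectors of
angle `θ < π / 2` and `θ` then tends to `π / 2`. The multiplier `e^{i a z²}` has modulus one on the
real axis and is small inside the quadrant. -/
lemma norm_le_on_quadrant {g : ℂ → ℂ} (hg : Differentiable ℂ g) {C : ℝ}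
    (hre : ∀ z, ‖g z‖ ≤ C * Real.exp (Real.pi * z.re ^ 2 / 2))
    (him : ∀ z, ‖g z‖ ≤ C * Real.exp (Real.pi * z.im ^ 2 / 2)) {z : ℂ}
    (hx : 0 ≤ z.re) (hy : 0 ≤ z.im) : ‖g z‖ ≤ C := by
  have hpi := Real.pi_pos
  have hC : 0 ≤ C := by
    have := (norm_nonneg _).trans (hre 0)
    simpa using this
  rcases hx.eq_or_lt with hx | hx
  · simpa [← hx] using hre z
  rcases hy.eq_or_lt with hy | hy
  · simpa [← hy] using him z
  have hz : z ≠ 0 := by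
    rintro rfl
    simp at hx
  have harg0 : 0 ≤ z.arg := Complex.arg_nonneg_iff.2 hy.le
  have harg : z.arg < Real.pi / 2 := (abs_lt.1 (Complex.abs_arg_lt_pi_div_two_iff.2 (Or.inl hx))).2
  have key : ∀ θ : ℝ, z.arg < θ → θ < Real.pi / 2 →
      ‖g z‖ ≤ C * Real.exp (Real.pi / 2 * (Real.cos θ / Real.sin θ) * (z.re * z.im)) := by
    intro θ hθ1 hθ2
    have hθ0 : 0 < θ := harg0.trans_lt hθ1
    have hsin : 0 < Real.sin θ := Real.sin_pos_of_pos_of_lt_pi hθ0 (by linarith)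
    have hcos : 0 < Real.cos θ := Real.cos_pos_of_mem_Ioo ⟨by linarith, hθ2⟩
    -- Chosen so that on the ray of angle `θ` the decay `e^{-2 a r² cos θ sin θ}` exactly cancels
    -- the growth `e^{π r² cos² θ / 2}`.
    set a : ℝ := Real.pi / 4 * (Real.cos θ / Real.sin θ) with ha
    have ha0 : 0 ≤ a := by positivity
    have hle := norm_le_on_sector (g := fun w => g w * Complex.exp (a * Complex.I * w ^ 2))
      (by fun_prop) (A := C) (K := Real.pi / 2 + 2 * a) (C := C) (θ := θ) (by positivity)
      ?_ hθ0 hθ2 ?_ ?_ (ζ := Complex.log z) (by rwa [Complex.log_im])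
      (by rw [Complex.log_im]; exact hθ1.le)
    · simp only [Complex.exp_log hz, norm_mul, norm_exp_I_mul_sq] at hle
      calc ‖g z‖ = ‖g z‖ * Real.exp (-(2 * a * (z.re * z.im))) *
            Real.exp (2 * a * (z.re * z.im)) := by
            rw [mul_assoc, ← Real.exp_add]
            simp
        _ ≤ C * Real.exp (2 * a * (z.re * z.im)) := by gcongr
        _ = _ := by
            rw [ha]
            ring_nf
    · intro w
      rw [norm_mul, norm_exp_I_mul_sq]
      have h1 := hre w
      have h2 : w.re ^ 2 ≤ ‖w‖ ^ 2 := by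
        rw [Complex.sq_norm, Complex.normSq_apply]
        nlinarith [sq_nonneg w.im]
      have h3 : -(w.re * w.im) ≤ ‖w‖ ^ 2 := by
        rw [Complex.sq_norm, Complex.normSq_apply]
        nlinarith [sq_nonneg (w.re + w.im), sq_nonneg w.re, sq_nonneg w.im]
      calc _ ≤ C * Real.exp (Real.pi * w.re ^ 2 / 2) * Real.exp (-(2 * a * (w.re * w.im))) := by
            gcongr
        _ = C * Real.exp (Real.pi * w.re ^ 2 / 2 + -(2 * a * (w.re * w.im))) := by
            rw [mul_assoc, ← Real.exp_add]
        _ ≤ _ := by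
            gcongr
            nlinarith
    · intro r _
      rw [norm_mul, norm_exp_I_mul_sq]
      simpa using him r
    · intro r _
      rw [norm_mul, norm_exp_I_mul_sq]
      have hr : ((r : ℂ) * Complex.exp (θ * Complex.I)).re = r * Real.cos θ := by
        simp [Complex.exp_ofReal_mul_I_re]
      have hi : ((r : ℂ) * Complex.exp (θ * Complex.I)).im = r * Real.sin θ := by
        simp [Complex.exp_ofReal_mul_I_im]
      have h := hre (r * Complex.exp (θ * Complex.I))
      rw [hr] at h
      rw [hr, hi]
      calc _ ≤ C * Real.exp (Real.pi * (r * Real.cos θ) ^ 2 / 2) *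
            Real.exp (-(2 * a * (r * Real.cos θ * (r * Real.sin θ)))) := by gcongr
        _ = C * Real.exp (Real.pi * (r * Real.cos θ) ^ 2 / 2 +
            -(2 * a * (r * Real.cos θ * (r * Real.sin θ)))) := by
            rw [mul_assoc, ← Real.exp_add]
        _ = C * Real.exp 0 := by
            congr 2
            rw [ha]
            field_simp
            ring
        _ = C := by simp
  -- The loss `e^{2 a x y}` disappears in the limit since `cot θ → 0`.
  have hlim : Tendsto (fun θ : ℝ =>
      C * Real.exp (Real.pi / 2 * (Real.cos θ / Real.sin θ) * (z.re * z.im)))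
      (𝓝[<] (Real.pi / 2)) (𝓝 C) := by
    have hc : ContinuousAt (fun θ : ℝ =>
        C * Real.exp (Real.pi / 2 * (Real.cos θ / Real.sin θ) * (z.re * z.im))) (Real.pi / 2) := by
      have : Real.sin (Real.pi / 2) ≠ 0 := by simp
      fun_prop (disch := exact this)
    have := hc.tendsto
    simp only [Real.cos_pi_div_two, zero_div, mul_zero, zero_mul, Real.exp_zero, mul_one] at this
    exact this.mono_left nhdsWithin_le_nhds
  refine ge_of_tendsto hlim ?_
  filter_upwards [Ioo_mem_nhdsLT harg] with θ hθ
  exact key θ hθ.1 hθ.2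

/-- An entire function dominated by `e^{π x² / 2}` and by `e^{π y² / 2}` is bounded. -/
lemma norm_le_of_norm_le_exp_re_of_norm_le_exp_im {g : ℂ → ℂ} (hg : Differentiable ℂ g) {C : ℝ}
    (hre : ∀ z, ‖g z‖ ≤ C * Real.exp (Real.pi * z.re ^ 2 / 2))
    (him : ∀ z, ‖g z‖ ≤ C * Real.exp (Real.pi * z.im ^ 2 / 2)) (z : ℂ) : ‖g z‖ ≤ C := by
  -- A rotation by a fourth root of unity moves `z` to the first quadrant; the roots `± i` merely
  -- exchange the two hypotheses.
  have rot : ∀ u : ℂ, u = 1 ∨ u = -1 ∨ u = Complex.I ∨ u = -Complex.I →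
      0 ≤ (u * z).re → 0 ≤ (u * z).im → ‖g z‖ ≤ C := by
    intro u hu h1 h2
    have hu0 : u ≠ 0 := by rcases hu with rfl | rfl | rfl | rfl <;> simp
    have := norm_le_on_quadrant (g := fun w => g (u⁻¹ * w)) (by fun_prop) (C := C)
      (fun w => ?_) (fun w => ?_) h1 h2
    · simpa [hu0] using this
    · rcases hu with rfl | rfl | rfl | rfl
      · simpa using hre w
      · simpa using hre (-w)
      · simpa using him (-(Complex.I * w))
      · simpa using him (Complex.I * w)
    · rcases hu with rfl | rfl | rfl | rfl
      · simpa using him w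
      · simpa using him (-w)
      · simpa using hre (-(Complex.I * w))
      · simpa using hre (Complex.I * w)
  rcases le_total 0 z.re with h1 | h1 <;> rcases le_total 0 z.im with h2 | h2
  · exact rot 1 (by simp) (by simpa) (by simpa)
  · exact rot Complex.I (by simp) (by simpa) (by simpa)
  · exact rot (-Complex.I) (by simp) (by simpa) (by simpa)
  · exact rot (-1) (by simp) (by simpa) (by simpa)

/-! ### Gaussian decay and Hardy's uncertainty principle -/

/-- The constant `c` serves for large `|t|`; on a compact interval only local integrability is
available, whence the integrable term `v`. -/
lemma HasGaussianDecay.exists_bound {h : ℝ → ℂ} (hd : HasGaussianDecay h)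
    (hl : LocallyIntegrable h) :
    ∃ (v : ℝ → ℝ) (c : ℝ), Integrable v ∧ (∀ t, 0 ≤ v t) ∧ 0 ≤ c ∧
      ∀ᵐ t, ‖h t‖ * Real.exp (Real.pi * t ^ 2) ≤ v t + c := by
  obtain ⟨c, hc, hb⟩ := hd.exists_pos
  rw [isBigOWith_iff, Filter.eventually_iff, mem_inf_iff_superset] at hb
  obtain ⟨s₁, hs₁, s₂, hs₂, hsub⟩ := hb
  rw [← Metric.cobounded_eq_cocompact, hasBasis_cobounded_norm.mem_iff] at hs₁
  obtain ⟨M, -, hM⟩ := hs₁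
  refine ⟨fun t => Real.exp (Real.pi * M ^ 2) * (Set.Icc (-M) M).indicator (fun t => ‖h t‖) t, c,
    ?_, fun t => ?_, hc.le, ?_⟩
  · refine Integrable.const_mul ?_ _
    rw [integrable_indicator_iff measurableSet_Icc]
    exact (hl.integrableOn_isCompact isCompact_Icc).norm
  · exact mul_nonneg (Real.exp_pos _).le (Set.indicator_nonneg (fun _ _ => norm_nonneg _) _)
  · filter_upwards [hs₂] with t ht
    by_cases hm : M ≤ ‖t‖
    · have h1 : ‖h t‖ ≤ c * ‖Real.exp (-Real.pi * t ^ 2)‖ := hsub ⟨hM hm, ht⟩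
      rw [Real.norm_of_nonneg (Real.exp_pos _).le] at h1
      have h2 : ‖h t‖ * Real.exp (Real.pi * t ^ 2) ≤ c := by
        calc _ ≤ c * Real.exp (-Real.pi * t ^ 2) * Real.exp (Real.pi * t ^ 2) := by gcongr
          _ = c := by
            rw [mul_assoc, ← Real.exp_add]
            simp
      have h3 : 0 ≤ Real.exp (Real.pi * M ^ 2) *
          (Set.Icc (-M) M).indicator (fun t => ‖h t‖) t :=
        mul_nonneg (Real.exp_pos _).le (Set.indicator_nonneg (fun _ _ => norm_nonneg _) _)
      linarith
    · push Not at hm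
      have hm' := abs_lt.1 hm
      rw [Set.indicator_of_mem (show t ∈ Set.Icc (-M) M from ⟨hm'.1.le, hm'.2.le⟩), mul_comm]
      have : Real.exp (Real.pi * t ^ 2) ≤ Real.exp (Real.pi * M ^ 2) := by
        apply Real.exp_le_exp.2
        have : t ^ 2 ≤ M ^ 2 := sq_le_sq' hm'.1.le hm'.2.le
        nlinarith [Real.pi_pos]
      nlinarith [norm_nonneg (h t)]

lemma HasGaussianDecay.integrable {h : ℝ → ℂ} (hd : HasGaussianDecay h)
    (hl : LocallyIntegrable h) : Integrable h := by
  obtain ⟨v, c, hv, hv0, hc, hb⟩ := hd.exists_bound hl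
  refine (hv.add ((integrable_exp_neg_mul_sq Real.pi_pos).const_mul c)).mono'
    hl.aestronglyMeasurable ?_
  filter_upwards [hb] with t ht
  have h1 : Real.exp (-Real.pi * t ^ 2) ≤ 1 := by
    apply Real.exp_le_one_iff.2
    nlinarith [Real.pi_pos, sq_nonneg t]
  calc ‖h t‖ = ‖h t‖ * Real.exp (Real.pi * t ^ 2) * Real.exp (-Real.pi * t ^ 2) := by
        rw [mul_assoc, ← Real.exp_add]
        simp
    _ ≤ (v t + c) * Real.exp (-Real.pi * t ^ 2) := by gcongr
    _ ≤ v t + c * Real.exp (-Real.pi * t ^ 2) := by nlinarith [hv0 t]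

lemma HasGaussianDecay.exists_integral_le {h : ℝ → ℂ} (hd : HasGaussianDecay h)
    (hl : LocallyIntegrable h) :
    ∃ C : ℝ, ∀ x : ℝ, ∫ t, ‖h t‖ * Real.exp (-Real.pi * t ^ 2 + 2 * Real.pi * x * t) ≤
      C * Real.exp (Real.pi * x ^ 2 / 2) := by
  obtain ⟨v, c, hv, hv0, hc, hb⟩ := hd.exists_bound hl
  refine ⟨(∫ t, v t) + c * ∫ t : ℝ, Real.exp (-(2 * Real.pi) * t ^ 2), fun x => ?_⟩
  have hg := integrable_exp_neg_mul_sq (b := 2 * Real.pi) (by positivity)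
  have hgx := hg.comp_sub_right (x / 2)
  have heq : (∫ t, v t) + c * ∫ t : ℝ, Real.exp (-(2 * Real.pi) * t ^ 2) =
      ∫ t, (v t + c * Real.exp (-(2 * Real.pi) * (t - x / 2) ^ 2)) := by
    rw [integral_add hv (hgx.const_mul c), integral_const_mul,
      integral_sub_right_eq_self (fun t : ℝ => Real.exp (-(2 * Real.pi) * t ^ 2)) (x / 2)]
  rw [heq, ← integral_mul_const]
  refine integral_mono_of_nonneg (Eventually.of_forall fun t => by positivity)
    ((hv.add (hgx.const_mul c)).mul_const _) ?_
  filter_upwards [hb] with t ht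
  have h1 : Real.exp (-(2 * Real.pi) * (t - x / 2) ^ 2) ≤ 1 := by
    apply Real.exp_le_one_iff.2
    nlinarith [Real.pi_pos, sq_nonneg (t - x / 2)]
  -- Completing the square around `x / 2`; the growth `e^{π x² / 2}` comes from here.
  have h2 : Real.exp (-Real.pi * t ^ 2 + 2 * Real.pi * x * t) = Real.exp (Real.pi * t ^ 2) *
      (Real.exp (-(2 * Real.pi) * (t - x / 2) ^ 2) * Real.exp (Real.pi * x ^ 2 / 2)) := by
    rw [← Real.exp_add, ← Real.exp_add]
    congr 1
    ring
  rw [h2, ← mul_assoc, ← mul_assoc]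
  gcongr
  calc _ ≤ (v t + c) * Real.exp (-(2 * Real.pi) * (t - x / 2) ^ 2) := by gcongr
    _ ≤ _ := by nlinarith [hv0 t]

lemma norm_exp_neg_mul_sq_div_two (s : ℂ) :
    ‖Complex.exp (-Real.pi * s ^ 2 / 2)‖ =
      Real.exp (-(Real.pi * s.re ^ 2 / 2)) * Real.exp (Real.pi * s.im ^ 2 / 2) := by
  rw [Complex.norm_exp, ← Real.exp_add]
  congr 1
  simp [pow_two]
  ring

lemma norm_gaussLaplace_le (f : ℝ → ℂ) (s : ℂ) :
    ‖gaussLaplace f s‖ ≤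
      ∫ t, ‖f t‖ * Real.exp (-Real.pi * t ^ 2 + 2 * Real.pi * s.re * t) := by
  refine (norm_integral_le_integral_norm _).trans_eq ?_
  congr 1
  ext t
  rw [norm_mul, norm_gaussLaplace_kernel]

/-- The Bargmann transform intertwines the Fourier transform with a rotation by a right angle. -/
lemma gaussLaplace_eq_gaussLaplace_fourier {f : ℝ → ℂ} (hf : Integrable f) (s : ℂ) :
    gaussLaplace f s =
      Complex.exp (Real.pi * s ^ 2) * gaussLaplace (𝓕 f) (Complex.I * s) := by
  have hG := fourier_gaussian_pi' (b := 1) (by simp) (Complex.I * s)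
  have hint : Integrable fun x : ℝ =>
      Complex.exp (-Real.pi * 1 * x ^ 2 + 2 * Real.pi * (Complex.I * s) * x) := by
    have := integrable_cexp_quadratic' (b := -Real.pi * 1) (by simp [Real.pi_pos])
      (2 * Real.pi * (Complex.I * s)) 0
    simpa using this
  -- The multiplication formula moves the Fourier transform from `f` to a Gaussian with a linear
  -- term, whose transform is explicit.
  have := VectorFourier.integral_fourierIntegral_smul_eq_flip (L := innerₗ ℝ)
    (μ := volume) (ν := volume) (f := f) Real.continuous_fourierChar
      (by simpa using! continuous_inner) hf hint
  simp only [flip_innerₗ] at this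
  change ∫ ξ, (𝓕 f) ξ • _ = ∫ x, f x • (𝓕 fun x : ℝ =>
      Complex.exp (-Real.pi * 1 * x ^ 2 + 2 * Real.pi * (Complex.I * s) * x)) x at this
  rw [hG] at this
  simp only [smul_eq_mul, mul_one] at this
  rw [gaussLaplace, gaussLaplace, this, ← integral_const_mul]
  congr 1
  ext t
  rw [mul_left_comm]
  congr 1
  simp only [Complex.one_cpow, div_one, one_mul]
  rw [← Complex.exp_add]
  congr 1
  linear_combination (2 * Real.pi * t * s + Real.pi * s ^ 2 * (Complex.I ^ 2 - 1)) *
    Complex.I_sq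

/-- Hardy's uncertainty principle, in terms of the Bargmann transform. -/
lemma bargmann_bounded_of_hasGaussianDecay {f : ℝ → ℂ} (hf : MemLp f 2 volume)
    (h1 : HasGaussianDecay f) (h2 : HasGaussianDecay (𝓕 f)) :
    ∃ C, ∀ s, ‖bargmann f s‖ ≤ C := by
  have hloc : LocallyIntegrable f := hf.locallyIntegrable (by norm_num)
  have hint : Integrable f := h1.integrable hloc
  have hcont : Continuous (𝓕 f) :=
    VectorFourier.fourierIntegral_continuous Real.continuous_fourierChar
      (by simpa using! continuous_inner) hint
  obtain ⟨C₁, hC₁⟩ := h1.exists_integral_le hloc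
  obtain ⟨C₂, hC₂⟩ := h2.exists_integral_le hcont.locallyIntegrable
  have b1 : ∀ s, ‖bargmann f s‖ ≤ C₁ * Real.exp (Real.pi * s.im ^ 2 / 2) := by
    intro s
    rw [bargmann, norm_mul, norm_exp_neg_mul_sq_div_two]
    calc _ ≤ Real.exp (-(Real.pi * s.re ^ 2 / 2)) * Real.exp (Real.pi * s.im ^ 2 / 2) *
          (C₁ * Real.exp (Real.pi * s.re ^ 2 / 2)) := by
          gcongr
          exact (norm_gaussLaplace_le f s).trans (hC₁ s.re)
      _ = C₁ * Real.exp (Real.pi * s.im ^ 2 / 2) *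
          (Real.exp (-(Real.pi * s.re ^ 2 / 2)) * Real.exp (Real.pi * s.re ^ 2 / 2)) := by ring
      _ = _ := by
          rw [← Real.exp_add]
          simp
  have b2 : ∀ s, ‖bargmann f s‖ ≤ C₂ * Real.exp (Real.pi * s.re ^ 2 / 2) := by
    intro s
    have hn : ‖Complex.exp (Real.pi * s ^ 2)‖ =
        Real.exp (Real.pi * s.re ^ 2) * Real.exp (-(Real.pi * s.im ^ 2)) := by
      rw [Complex.norm_exp, ← Real.exp_add]
      congr 1
      simp [pow_two]
      ring
    rw [bargmann, norm_mul, norm_exp_neg_mul_sq_div_two,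
      gaussLaplace_eq_gaussLaplace_fourier hint, norm_mul, hn]
    have h3 := (norm_gaussLaplace_le (𝓕 f) (Complex.I * s)).trans (hC₂ _)
    have h4 : (Complex.I * s).re ^ 2 = s.im ^ 2 := by simp
    rw [h4] at h3
    calc _ ≤ Real.exp (-(Real.pi * s.re ^ 2 / 2)) * Real.exp (Real.pi * s.im ^ 2 / 2) *
          (Real.exp (Real.pi * s.re ^ 2) * Real.exp (-(Real.pi * s.im ^ 2)) *
            (C₂ * Real.exp (Real.pi * s.im ^ 2 / 2))) := by
          gcongr
      _ = C₂ * (Real.exp (-(Real.pi * s.re ^ 2 / 2)) * Real.exp (Real.pi * s.im ^ 2 / 2) *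
          Real.exp (Real.pi * s.re ^ 2) * Real.exp (-(Real.pi * s.im ^ 2)) *
            Real.exp (Real.pi * s.im ^ 2 / 2)) := by ring
      _ = _ := by
          simp only [← Real.exp_add]
          ring_nf
  have nn : ∀ C' : ℝ, C' ≤ max C₁ C₂ → ∀ y : ℝ, C' * Real.exp y ≤ max C₁ C₂ * Real.exp y :=
    fun C' h y => by gcongr
  exact ⟨max C₁ C₂, norm_le_of_norm_le_exp_re_of_norm_le_exp_im (differentiable_bargmann hf)
    (fun s => (b2 s).trans (nn _ (le_max_right _ _) _))
    (fun s => (b1 s).trans (nn _ (le_max_left _ _) _))⟩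

/-! ### From the eigenvalue equation to vanishing moments -/

lemma stft_congr_ae {g f₁ f₂ : ℝ → ℂ} (h : f₁ =ᵐ[volume] f₂) (z : ℂ) :
    stft g f₁ z = stft g f₂ z := by
  refine integral_congr_ae ?_
  filter_upwards [h] with t ht
  rw [ht]

/-- The weighted exponential moments of a planar set. -/
noncomputable def expMoment (Ω : Set ℂ) (n : ℕ) (t : ℝ) : ℂ :=
  ∫ z in Ω, z ^ n *
    Complex.exp (2 * Real.pi * t * z - Real.pi * z ^ 2 / 2 - Real.pi * (‖z‖ : ℂ) ^ 2)

/-- The localization operator applied to the standard Gaussian. -/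
lemma locOp_gaussian {Ω : Set ℂ} (hΩ : MeasurableSet Ω) {f : ℝ → ℂ} {c : ℂ}
    (hf : f =ᵐ[volume] fun t : ℝ => c * Complex.exp (-Real.pi * t ^ 2)) (t : ℝ) :
    locOp Ω f t = (((2 : ℝ) ^ (1 / 4 : ℝ) : ℝ) : ℂ) ^ 2 * (1 / 2 : ℂ) ^ (1 / 2 : ℂ) * c *
      Complex.exp (-Real.pi * t ^ 2) * expMoment Ω 0 t := by
  unfold locOp locOpSymbol expMoment
  have h1 : (fun z : ℂ => Ω.indicator (fun _ => (1 : ℂ)) z * stft gaussianWindow f z *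
      tfShift z gaussianWindow t) =
      Ω.indicator fun z => stft gaussianWindow f z * tfShift z gaussianWindow t := by
    ext z
    by_cases hz : z ∈ Ω <;> simp [hz]
  rw [h1, integral_indicator hΩ, ← integral_const_mul]
  congr 1
  ext z
  have h2 : gaussLaplace (fun t : ℝ => c * Complex.exp (-Real.pi * t ^ 2)) ((starRingEnd ℂ) z) =
      c * ((1 / 2 : ℂ) ^ (1 / 2 : ℂ) *
        Complex.exp (Real.pi * (z.re - Complex.I * z.im) ^ 2 / 2)) := by
    have hz : (starRingEnd ℂ) z = z.re - Complex.I * z.im := by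
      apply Complex.ext <;> simp
    rw [← hz, ← gaussLaplace_gaussian, gaussLaplace, gaussLaplace, ← integral_const_mul]
    congr 1
    ext t
    ring
  have h3 : gaussianWindow (t - z.re) =
      (((2 : ℝ) ^ (1 / 4 : ℝ) : ℝ) : ℂ) * Complex.exp (-Real.pi * (t - z.re) ^ 2) := by
    rw [gaussianWindow]
    push_cast
    rfl
  rw [stft_congr_ae hf, stft_gaussianWindow_eq, h2, tfShift, h3, pow_zero, one_mul]
  have h4 : Complex.exp (-Real.pi * z.re ^ 2) *
      Complex.exp (Real.pi * (z.re - Complex.I * z.im) ^ 2 / 2) *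
      Complex.exp (-Real.pi * (t - z.re) ^ 2) * Complex.exp (2 * Real.pi * Complex.I * z.im * t) =
      Complex.exp (-Real.pi * t ^ 2) *
        Complex.exp (2 * Real.pi * t * z - Real.pi * z ^ 2 / 2 - Real.pi * (‖z‖ : ℂ) ^ 2) := by
    have hn : (‖z‖ : ℂ) ^ 2 = (z.re : ℂ) ^ 2 + (z.im : ℂ) ^ 2 := by
      rw [← Complex.ofReal_pow, Complex.sq_norm, Complex.normSq_apply]
      push_cast
      ring
    simp only [← Complex.exp_add]
    congr 1
    rw [hn]
    conv_rhs => rw [← Complex.re_add_im z]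
    simp only [Complex.add_re, Complex.ofReal_re, Complex.mul_re, Complex.I_re, Complex.ofReal_im,
      Complex.I_im, Complex.add_im, Complex.mul_im, mul_zero, mul_one, add_zero, zero_add,
      sub_self]
    linear_combination (Real.pi * (z.im : ℂ) ^ 2) * Complex.I_sq
  linear_combination (((2 : ℝ) ^ (1 / 4 : ℝ) : ℝ) : ℂ) ^ 2 * (1 / 2 : ℂ) ^ (1 / 2 : ℂ) * c * h4

lemma integrableOn_of_isBounded {Ω : Set ℂ} (hb : Bornology.IsBounded Ω) {F : ℂ → ℂ}
    (hF : Continuous F) : IntegrableOn F Ω :=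
  (hF.continuousOn.integrableOn_compact hb.isCompact_closure).mono_set subset_closure

lemma hasDerivAt_expMoment {Ω : Set ℂ} (hm : MeasurableSet Ω) (hb : Bornology.IsBounded Ω) (n : ℕ)
    (t₀ : ℝ) : HasDerivAt (expMoment Ω n) (2 * Real.pi * expMoment Ω (n + 1) t₀) t₀ := by
  have hcont : Continuous fun p : ℝ × ℂ => 2 * Real.pi * (p.2 ^ (n + 1) *
      Complex.exp (2 * Real.pi * p.1 * p.2 - Real.pi * p.2 ^ 2 / 2 -
        Real.pi * (‖p.2‖ : ℂ) ^ 2)) := by fun_prop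
  obtain ⟨B, hB⟩ := ((isCompact_closedBall t₀ 1).prod hb.isCompact_closure).exists_bound_of_continuousOn
    hcont.continuousOn
  have key := hasDerivAt_integral_of_dominated_loc_of_deriv_le (μ := volume.restrict Ω)
    (F := fun (t : ℝ) (z : ℂ) => z ^ n *
      Complex.exp (2 * Real.pi * t * z - Real.pi * z ^ 2 / 2 - Real.pi * (‖z‖ : ℂ) ^ 2))
    (F' := fun (t : ℝ) (z : ℂ) => 2 * Real.pi * (z ^ (n + 1) *
      Complex.exp (2 * Real.pi * t * z - Real.pi * z ^ 2 / 2 - Real.pi * (‖z‖ : ℂ) ^ 2)))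
    (x₀ := t₀) (s := Metric.ball t₀ 1) (Metric.ball_mem_nhds _ one_pos)
    (bound := fun _ => B)
    (Eventually.of_forall fun t => Continuous.aestronglyMeasurable (by fun_prop))
    (integrableOn_of_isBounded hb (by fun_prop))
    (Continuous.aestronglyMeasurable (by fun_prop)) ?_
    (integrableOn_const hb.measure_lt_top.ne) ?_
  · refine key.2.congr_deriv ?_
    rw [integral_const_mul]
    rfl
  · refine (ae_restrict_iff' hm).2 (Eventually.of_forall fun z hz t ht => ?_)
    exact hB (t, z) ⟨Metric.ball_subset_closedBall ht, subset_closure hz⟩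
  · refine Eventually.of_forall fun z t _ => ?_
    have h1 : HasDerivAt (fun t : ℝ => (2 * Real.pi * t * z - Real.pi * z ^ 2 / 2 -
        Real.pi * (‖z‖ : ℂ) ^ 2 : ℂ)) (2 * Real.pi * z) t := by
      have := ((((hasDerivAt_id t).ofReal_comp.const_mul (2 * Real.pi : ℂ)).mul_const z).sub_const
        (Real.pi * z ^ 2 / 2 : ℂ)).sub_const (Real.pi * (‖z‖ : ℂ) ^ 2 : ℂ)
      simpa using this
    refine (h1.cexp.const_mul (z ^ n)).congr_deriv ?_
    ring

/-- Continuity upgrades the almost everywhere identity to every `t`; each differentiation then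
raises the moment by one, up to a factor `2π`. -/
lemma expMoment_succ_eq_zero {Ω : Set ℂ} (hm : MeasurableSet Ω) (hb : Bornology.IsBounded Ω)
    {c : ℂ} (hc : ∀ᵐ t : ℝ, expMoment Ω 0 t = c) (n : ℕ) (t : ℝ) :
    expMoment Ω (n + 1) t = 0 := by
  have hd := hasDerivAt_expMoment hm hb
  have step : ∀ k (c' : ℂ), (∀ t, expMoment Ω k t = c') → ∀ t, expMoment Ω (k + 1) t = 0 := by
    intro k c' h t
    have h1 := hd k t
    rw [show expMoment Ω k = fun _ => c' from funext h] at h1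
    have h2 := h1.unique (hasDerivAt_const t c')
    have hpi : (2 * Real.pi : ℂ) ≠ 0 := by simp [Real.pi_ne_zero]
    exact (mul_eq_zero.1 h2).resolve_left hpi
  induction n generalizing t with
  | zero =>
    refine step 0 c (fun t => ?_) t
    have hcont : Continuous (expMoment Ω 0) :=
      continuous_iff_continuousAt.2 fun t => (hd 0 t).continuousAt
    exact congrFun ((hcont.ae_eq_iff_eq volume continuous_const).1 hc) t
  | succ n ih => exact step (n + 1) 0 ih t

/-- A finite measure on a disc whose moments vanish annihilates functions holomorphic on a larger
disc. -/
lemma integral_mul_eq_zero_of_moments {Ω : Set ℂ} (hm : MeasurableSet Ω) {R ρ : ℝ} (hR : 0 ≤ R)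
    (hΩ : ∀ z ∈ Ω, ‖z‖ ≤ R) (hRρ : R < ρ) {k g : ℂ → ℂ} (hk : IntegrableOn k Ω)
    (hg : DifferentiableOn ℂ g (Metric.ball 0 ρ)) (h0 : ∀ n : ℕ, ∫ z in Ω, z ^ n * k z = 0) :
    ∫ z in Ω, g z * k z = 0 := by
  set a : ℕ → ℂ := fun n => (n.factorial : ℂ)⁻¹ * iteratedDeriv n g 0 with ha
  -- The Taylor series converges absolutely at radius `R < ρ`, which permits integration term by
  -- term over `Ω`.
  have hs : ∀ z : ℂ, ‖z‖ < ρ → HasSum (fun n => a n * z ^ n) (g z) := by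
    intro z hz
    have := Complex.hasSum_taylorSeries_on_ball hg (z := z) (by simpa using hz)
    have e : (fun n => a n * z ^ n) =
        fun n : ℕ => (n.factorial : ℂ)⁻¹ • (z - 0) ^ n • iteratedDeriv n g 0 := by
      ext n
      simp only [ha, sub_zero, smul_eq_mul]
      ring
    rwa [e]
  have hsumR : Summable fun n => ‖a n‖ * R ^ n := by
    have := (hs R (by rwa [Complex.norm_real, Real.norm_of_nonneg hR])).summable.norm
    simpa [abs_of_nonneg hR] using this
  have hint : ∀ n, Integrable (fun z => a n * z ^ n * k z) (volume.restrict Ω) := by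
    intro n
    refine Integrable.bdd_mul (c := ‖a n‖ * R ^ n) hk
      (Continuous.aestronglyMeasurable (by fun_prop)) ?_
    refine (ae_restrict_iff' hm).2 (Eventually.of_forall fun z hz => ?_)
    rw [norm_mul, norm_pow]
    have := hΩ z hz
    gcongr
  have hS : Summable fun n => ∫ z in Ω, ‖a n * z ^ n * k z‖ := by
    refine Summable.of_nonneg_of_le (fun n => integral_nonneg fun z => norm_nonneg _)
      (fun n => ?_) (hsumR.mul_right (∫ z in Ω, ‖k z‖))
    rw [← integral_const_mul]
    refine setIntegral_mono_on (hint n).norm (hk.norm.const_mul _) hm fun z hz => ?_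
    rw [norm_mul, norm_mul, norm_pow]
    have := hΩ z hz
    gcongr
  have hsum := hasSum_integral_of_summable_integral_norm hint hS
  have hzero : ∀ n, ∫ z in Ω, a n * z ^ n * k z = 0 := by
    intro n
    simp_rw [mul_assoc]
    rw [integral_const_mul, h0, mul_zero]
  simp_rw [hzero] at hsum
  have := hsum.unique hasSum_zero
  rw [← this]
  refine setIntegral_congr_fun hm fun z hz => ?_
  exact (((hs z ((hΩ z hz).trans_lt hRρ)).mul_right (k z)).tsum_eq).symm

/-- The factor `e^{π z² / 2}` is holomorphic, so it can be put into the test function to cancel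
`e^{-π z² / 2}` in the moments. The numerator `z` is there because the moment of order zero need not
vanish. -/
lemma integral_div_sub_eq_zero {Ω : Set ℂ} (hm : MeasurableSet Ω) {R : ℝ} (hR : 0 ≤ R)
    (hΩ : ∀ z ∈ Ω, ‖z‖ ≤ R) (h0 : ∀ n, expMoment Ω (n + 1) 0 = 0) {w : ℂ} (hw : R < ‖w‖) :
    ∫ z in Ω, z / (w - z) * (Real.exp (-Real.pi * ‖z‖ ^ 2) : ℂ) = 0 := by
  have hb : Bornology.IsBounded Ω := isBounded_iff_forall_norm_le.2 ⟨R, hΩ⟩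
  have hg : DifferentiableOn ℂ (fun z => Complex.exp (Real.pi * z ^ 2 / 2) / (w - z))
      (Metric.ball 0 ‖w‖) := by
    intro z hz
    have hne : w - z ≠ 0 := by
      intro h
      rw [sub_eq_zero.1 h] at hz
      simp at hz
    exact (DifferentiableAt.div (by fun_prop) (by fun_prop) hne).differentiableWithinAt
  rw [← integral_mul_eq_zero_of_moments hm hR hΩ hw (g := fun z =>
    Complex.exp (Real.pi * z ^ 2 / 2) / (w - z)) (k := fun z => z *
      Complex.exp (-(Real.pi * z ^ 2 / 2) - Real.pi * (‖z‖ : ℂ) ^ 2))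
    (integrableOn_of_isBounded hb (by fun_prop)) hg]
  · congr 1
    ext z
    have : Complex.exp (Real.pi * z ^ 2 / 2) *
        Complex.exp (-(Real.pi * z ^ 2 / 2) - Real.pi * (‖z‖ : ℂ) ^ 2) =
        (Real.exp (-Real.pi * ‖z‖ ^ 2) : ℂ) := by
      rw [← Complex.exp_add]
      push_cast
      congr 1
      ring
    rw [← this]
    ring
  · intro n
    rw [← h0 n, expMoment]
    congr 1
    ext z
    simp only [pow_succ z n, mul_assoc, Complex.ofReal_zero, zero_mul, mul_zero, zero_sub]

/-! ### Regularity of the Cauchy transform -/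

/-- The Cauchy transform `∫_E e^{-π|z|²} / (w - z) dz` of the Gaussian measure restricted to `E`. -/
noncomputable def cauchyGauss (E : Set ℂ) (w : ℂ) : ℂ :=
  ∫ z in E, (Real.exp (-Real.pi * ‖z‖ ^ 2) : ℂ) / (w - z)

lemma integrable_gauss_norm_sq : Integrable fun z : ℂ => Real.exp (-Real.pi * ‖z‖ ^ 2) := by
  have := (GaussianFourier.integrable_cexp_neg_mul_sq_norm_add (V := ℂ) (b := Real.pi)
    (by simp [Real.pi_pos]) 0 0).norm
  refine this.congr (Eventually.of_forall fun z => ?_)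
  simp only [Complex.norm_exp]
  congr 1
  simp [← Complex.ofReal_pow]

/-- In polar coordinates the Jacobian cancels the singularity of `1 / |u|`. -/
lemma integrable_indicator_inv_norm {δ : ℝ} (hδ : 0 < δ) :
    Integrable (fun u : ℂ => (Set.Iio δ).indicator (fun y : ℝ => y⁻¹) ‖u‖) ∧
      ∫ u : ℂ, (Set.Iio δ).indicator (fun y : ℝ => y⁻¹) ‖u‖ = 2 * Real.pi * δ := by
  have h : ∀ y ∈ Set.Ioi (0 : ℝ), y ^ (Module.finrank ℝ ℂ - 1) •
      (Set.Iio δ).indicator (fun y : ℝ => y⁻¹) y = (Set.Iio δ).indicator (fun _ => (1 : ℝ)) y := by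
    intro y hy
    rw [Complex.finrank_real_complex]
    by_cases hyd : y < δ
    · simp [hyd, (Set.mem_Ioi.1 hy).ne']
    · simp [hyd]
  have hvol : volume (Set.Iio δ ∩ Set.Ioi (0 : ℝ)) = ENNReal.ofReal δ := by
    rw [Set.Iio_inter_Ioi, Real.volume_Ioo, sub_zero]
  constructor
  · rw [integrable_fun_norm_addHaar (volume : Measure ℂ), integrableOn_congr_fun h measurableSet_Ioi,
      IntegrableOn, integrable_indicator_iff measurableSet_Iio]
    refine integrableOn_const ?_
    rw [Measure.restrict_apply measurableSet_Iio, hvol]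
    exact ENNReal.ofReal_ne_top
  · rw [integral_fun_norm_addHaar (volume : Measure ℂ),
      setIntegral_congr_fun measurableSet_Ioi h, integral_indicator measurableSet_Iio,
      Complex.finrank_real_complex]
    simp [Measure.real, hvol, hδ.le]
    ring

lemma norm_gauss_le_one (z : ℂ) : Real.exp (-Real.pi * ‖z‖ ^ 2) ≤ 1 := by
  apply Real.exp_le_one_iff.2
  nlinarith [Real.pi_pos, sq_nonneg ‖z‖]

lemma integrable_gauss_div (w : ℂ) :
    Integrable fun z : ℂ => (Real.exp (-Real.pi * ‖z‖ ^ 2) : ℂ) / (w - z) := by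
  have h := (integrable_indicator_inv_norm one_pos).1.comp_sub_left w
  refine (integrable_gauss_norm_sq.add h).mono'
    (Measurable.aestronglyMeasurable (by fun_prop)) (Eventually.of_forall fun z => ?_)
  rw [norm_div, Complex.norm_real, Real.norm_of_nonneg (Real.exp_pos _).le]
  simp only [Pi.add_apply]
  have h1 := norm_gauss_le_one z
  have h0 := Real.exp_pos (-Real.pi * ‖z‖ ^ 2)
  by_cases hz : ‖w - z‖ < 1
  · rw [Set.indicator_of_mem (Set.mem_Iio.2 hz), div_eq_mul_inv]
    have := inv_nonneg.2 (norm_nonneg (w - z))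
    nlinarith
  · rw [Set.indicator_of_notMem (by simpa using hz), add_zero]
    exact div_le_self h0.le (not_lt.1 hz)

/-- A bounded continuous truncation of `1 / u`. -/
noncomputable def truncInv (ε : ℝ) (u : ℂ) : ℂ := (starRingEnd ℂ) u / ((max ‖u‖ ε : ℝ) : ℂ) ^ 2

lemma continuous_truncInv {ε : ℝ} (hε : 0 < ε) : Continuous (truncInv ε) := by
  unfold truncInv
  refine Complex.continuous_conj.div (by fun_prop) fun u => ?_
  have : 0 < max ‖u‖ ε := lt_max_of_lt_right hε
  exact pow_ne_zero _ (by exact_mod_cast this.ne')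

lemma norm_truncInv_le {ε : ℝ} (hε : 0 < ε) (u : ℂ) : ‖truncInv ε u‖ ≤ ε⁻¹ := by
  have h : 0 < max ‖u‖ ε := lt_max_of_lt_right hε
  rw [truncInv, norm_div, norm_pow, Complex.norm_real, Complex.norm_conj,
    Real.norm_of_nonneg h.le, div_le_iff₀ (by positivity), pow_two, ← mul_assoc]
  have h1 : 1 ≤ ε⁻¹ * max ‖u‖ ε := by
    rw [← inv_mul_cancel₀ hε.ne']
    gcongr
    exact le_max_right _ _
  nlinarith [le_max_left ‖u‖ ε]

lemma norm_inv_sub_truncInv_le {ε : ℝ} (u : ℂ) :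
    ‖u⁻¹ - truncInv ε u‖ ≤ (Set.Iio ε).indicator (fun y : ℝ => y⁻¹) ‖u‖ := by
  rcases eq_or_ne u 0 with rfl | hu
  · simp only [truncInv, map_zero, zero_div, inv_zero, sub_zero, norm_zero]
    exact Set.indicator_apply_nonneg (by simp)
  have hu0 : 0 < ‖u‖ := norm_pos_iff.2 hu
  have hinv : u⁻¹ = (starRingEnd ℂ) u / ((‖u‖ : ℝ) : ℂ) ^ 2 := by
    rw [Complex.inv_def, Complex.normSq_eq_norm_sq]
    push_cast
    rfl
  by_cases h : ‖u‖ < ε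
  · have hε : 0 < ε := hu0.trans h
    rw [Set.indicator_of_mem (Set.mem_Iio.2 h), truncInv, max_eq_right h.le, hinv,
      div_eq_mul_inv, div_eq_mul_inv, ← mul_sub, norm_mul, Complex.norm_conj]
    have e : ((((‖u‖ : ℝ) : ℂ) ^ 2)⁻¹ - ((ε : ℂ) ^ 2)⁻¹) =
        (((‖u‖ ^ 2)⁻¹ - (ε ^ 2)⁻¹ : ℝ) : ℂ) := by
      push_cast
      rfl
    have h2 : (ε ^ 2)⁻¹ ≤ (‖u‖ ^ 2)⁻¹ := by gcongr
    rw [e, Complex.norm_real, Real.norm_of_nonneg (by linarith)]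
    have h3 : 0 ≤ (ε ^ 2)⁻¹ := by positivity
    calc _ ≤ ‖u‖ * (‖u‖ ^ 2)⁻¹ := by gcongr; linarith
      _ = ‖u‖⁻¹ := by field_simp
  · rw [Set.indicator_of_notMem (by simpa using h), truncInv, max_eq_left (not_lt.1 h), hinv]
    simp

/-- Truncating the kernel at scale `ε` gives a continuous function within `2π ε` of the transform,
uniformly in `w`. -/
lemma continuous_cauchyGauss (E : Set ℂ) : Continuous (cauchyGauss E) := by
  refine continuous_of_uniform_approx_of_continuous fun U hU => ?_
  obtain ⟨η, hη, hU⟩ := Metric.mem_uniformity_dist.1 hU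
  set ε : ℝ := η / (4 * Real.pi) with hεdef
  have hε : 0 < ε := by positivity
  have hm : ∀ w, AEStronglyMeasurable (fun z : ℂ =>
      (Real.exp (-Real.pi * ‖z‖ ^ 2) : ℂ) * truncInv ε (w - z)) (volume.restrict E) := by
    intro w
    have := continuous_truncInv hε
    exact Continuous.aestronglyMeasurable (by fun_prop)
  have hb : ∀ w z : ℂ, ‖(Real.exp (-Real.pi * ‖z‖ ^ 2) : ℂ) * truncInv ε (w - z)‖ ≤
      Real.exp (-Real.pi * ‖z‖ ^ 2) * ε⁻¹ := by
    intro w z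
    rw [norm_mul, Complex.norm_real,
      Real.norm_of_nonneg (Real.exp_pos _).le]
    gcongr
    exact norm_truncInv_le hε _
  have hbi := (integrable_gauss_norm_sq.mul_const ε⁻¹).restrict (s := E)
  refine ⟨fun w => ∫ z in E, (Real.exp (-Real.pi * ‖z‖ ^ 2) : ℂ) * truncInv ε (w - z), ?_,
    fun w => hU ?_⟩
  · refine continuous_of_dominated hm (fun w => Eventually.of_forall (hb w)) hbi
      (Eventually.of_forall fun z => ?_)
    have := continuous_truncInv hε
    fun_prop
  · have hi := (integrable_indicator_inv_norm hε).1.comp_sub_left w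
    rw [dist_eq_norm, cauchyGauss, ← integral_sub (integrable_gauss_div w).restrict
      (hbi.mono' (hm w) (Eventually.of_forall (hb w)))]
    calc _ ≤ ∫ z in E, (Set.Iio ε).indicator (fun y : ℝ => y⁻¹) ‖w - z‖ := by
          refine norm_integral_le_of_norm_le hi.restrict (Eventually.of_forall fun z => ?_)
          rw [div_eq_mul_inv, ← mul_sub, norm_mul, Complex.norm_real,
            Real.norm_of_nonneg (Real.exp_pos _).le]
          have h1 := norm_gauss_le_one z
          have h2 := norm_inv_sub_truncInv_le (ε := ε) (w - z)
          nlinarith [norm_nonneg ((w - z)⁻¹ - truncInv ε (w - z)),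
            Real.exp_pos (-Real.pi * ‖z‖ ^ 2)]
      _ ≤ ∫ z, (Set.Iio ε).indicator (fun y : ℝ => y⁻¹) ‖w - z‖ :=
          setIntegral_le_integral hi (Eventually.of_forall fun z =>
            Set.indicator_apply_nonneg fun _ => by positivity)
      _ = 2 * Real.pi * ε := by
          rw [integral_sub_left_eq_self
            (fun u : ℂ => (Set.Iio ε).indicator (fun y : ℝ => y⁻¹) ‖u‖) volume w,
            (integrable_indicator_inv_norm hε).2]
      _ < η := by
          rw [hεdef]
          field_simp
          linarith

lemma differentiableAt_cauchyGauss {E : Set ℂ} (hE : MeasurableSet E) {w₀ : ℂ}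
    (hw : w₀ ∉ closure E) : DifferentiableAt ℂ (cauchyGauss E) w₀ := by
  obtain ⟨d, hd, hball⟩ := Metric.isOpen_iff.1 isClosed_closure.isOpen_compl w₀ hw
  have far : ∀ z ∈ E, ∀ w ∈ Metric.ball w₀ (d / 2), d / 2 ≤ ‖w - z‖ := by
    intro z hz w hw
    by_contra! h
    refine hball (a := z) ?_ (subset_closure hz)
    rw [Metric.mem_ball] at hw ⊢
    rw [← dist_eq_norm, dist_comm] at h
    linarith [dist_triangle z w w₀]
  have key := hasDerivAt_integral_of_dominated_loc_of_deriv_le (μ := volume.restrict E)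
    (F := fun (w z : ℂ) => (Real.exp (-Real.pi * ‖z‖ ^ 2) : ℂ) / (w - z))
    (F' := fun (w z : ℂ) => -(Real.exp (-Real.pi * ‖z‖ ^ 2) : ℂ) / (w - z) ^ 2)
    (x₀ := w₀) (s := Metric.ball w₀ (d / 2)) (Metric.ball_mem_nhds _ (by positivity))
    (bound := fun z => Real.exp (-Real.pi * ‖z‖ ^ 2) * ((d / 2) ^ 2)⁻¹)
    (Eventually.of_forall fun w => (integrable_gauss_div w).restrict.1)
    (integrable_gauss_div w₀).restrict
    (Measurable.aestronglyMeasurable (by fun_prop)) ?_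
    (integrable_gauss_norm_sq.mul_const _).restrict ?_
  · exact key.2.differentiableAt
  · refine (ae_restrict_iff' hE).2 (Eventually.of_forall fun z hz w hw => ?_)
    rw [norm_div, norm_neg, Complex.norm_real,
      Real.norm_of_nonneg (Real.exp_pos _).le, div_eq_mul_inv, norm_pow]
    have := far z hz w hw
    gcongr
  · refine (ae_restrict_iff' hE).2 (Eventually.of_forall fun z hz w hw => ?_)
    have h0 : w - z ≠ 0 := by
      have := far z hz w hw
      rw [← norm_pos_iff]
      linarith
    have := ((hasDerivAt_id w).sub_const z).inv h0
    refine (this.const_mul (Real.exp (-Real.pi * ‖z‖ ^ 2) : ℂ)).congr_deriv ?_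
    simp only [id]
    ring

/-! ### The Cauchy transform of the whole plane, in polar coordinates -/

lemma integrableOn_polar {F : ℂ → ℂ} (hF : Integrable F) (hm : Measurable F) :
    IntegrableOn (fun p : ℝ × ℝ => p.1 • F (Complex.polarCoord.symm p)) polarCoord.target := by
  have hs : Measurable fun p : ℝ × ℝ => Complex.polarCoord.symm p := by
    simp only [Complex.polarCoord_symm_apply]
    fun_prop
  refine ⟨(measurable_fst.smul (hm.comp hs)).aestronglyMeasurable, ?_⟩
  rw [hasFiniteIntegral_iff_enorm]
  refine lt_of_eq_of_lt ?_ (hasFiniteIntegral_iff_enorm.1 hF.2)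
  rw [← Complex.lintegral_comp_polarCoord_symm]
  refine setLIntegral_congr_fun polarCoord.open_target.measurableSet fun p hp => ?_
  have hp1 : 0 < p.1 := hp.1
  simp only [enorm_smul, smul_eq_mul]
  rw [← ofReal_norm p.1, Real.norm_of_nonneg hp1.le]

/-- For `r < ‖w‖` this is the mean value property; for `r > ‖w‖` the residues at `0` and `w` cancel.
-/
lemma circleAverage_div_sub {w : ℂ} {r : ℝ} (hr : 0 < r) (hrw : r ≠ ‖w‖) :
    Real.circleAverage (fun z => w / (w - z)) 0 r = if r < ‖w‖ then 1 else 0 := by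
  split_ifs with h
  · have hne : ∀ z ∈ Metric.closedBall (0 : ℂ) r, w - z ≠ 0 := by
      intro z hz h0
      rw [← sub_eq_zero.1 h0, mem_closedBall_zero_iff] at hz
      linarith
    have hd : DiffContOnCl ℂ (fun z => w / (w - z)) (Metric.ball 0 |r|) := by
      rw [abs_of_pos hr]
      apply DifferentiableOn.diffContOnCl
      rw [closure_ball _ hr.ne']
      intro z hz
      have := hne z hz
      exact (DifferentiableAt.div (by fun_prop) (by fun_prop) this).differentiableWithinAt
    rw [hd.circleAverage]
    have := hne 0 (by simpa using hr.le)
    simp only [sub_zero] at this ⊢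
    exact div_self this
  · have hwr : ‖w‖ < r := lt_of_le_of_ne (not_lt.1 h) hrw.symm
    rw [Real.circleAverage_eq_circleIntegral hr.ne']
    have e : (∮ z in C(0, r), (z - 0)⁻¹ • (w / (w - z))) =
        ∮ z in C(0, r), ((z - 0)⁻¹ - (z - w)⁻¹) := by
      refine circleIntegral.integral_congr hr.le fun z hz => ?_
      have hz' : ‖z‖ = r := by simpa using hz
      have h0 : z ≠ 0 := by
        rintro rfl
        simp at hz'
        linarith
      have h1 : z - w ≠ 0 := by
        intro h1
        rw [sub_eq_zero.1 h1] at hz'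
        linarith
      have h2 : w - z ≠ 0 := by
        rw [← neg_sub]
        exact neg_ne_zero.2 h1
      simp only [sub_zero, smul_eq_mul]
      field_simp
      ring
    have ci : ∀ v : ℂ, ‖v‖ < r → CircleIntegrable (fun z => (z - v)⁻¹) 0 r := by
      intro v hv
      rw [circleIntegrable_sub_inv_iff]
      right
      rw [abs_of_pos hr]
      simpa using hv.ne
    rw [e, circleIntegral.integral_sub (ci 0 (by simpa)) (ci w hwr),
      circleIntegral.integral_sub_inv_of_mem_ball (by simpa using hr),
      circleIntegral.integral_sub_inv_of_mem_ball (by simpa using hwr)]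
    simp

lemma setIntegral_angle_div_sub {w : ℂ} {r : ℝ} (hr : 0 < r) (hrw : r ≠ ‖w‖) :
    ∫ θ in Set.Ioo (-Real.pi) Real.pi, w / (w - circleMap 0 r θ) =
      if r < ‖w‖ then 2 * Real.pi else 0 := by
  have h := circleAverage_div_sub hr hrw
  rw [Real.circleAverage, inv_smul_eq_iff₀ (by positivity)] at h
  have hper : Function.Periodic (fun θ => w / (w - circleMap 0 r θ)) (2 * Real.pi) := by
    intro θ
    change w / (w - circleMap 0 r (θ + 2 * Real.pi)) = _
    rw [periodic_circleMap 0 r θ]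
  have h2 := hper.intervalIntegral_add_eq (-Real.pi) 0
  rw [zero_add, show -Real.pi + 2 * Real.pi = Real.pi by ring] at h2
  rw [← integral_Ioc_eq_integral_Ioo,
    ← intervalIntegral.integral_of_le (by linarith [Real.pi_pos]), h2, h]
  split_ifs <;> simp

/-- The Cauchy transform of the Gaussian on the whole plane. -/
lemma mul_cauchyGauss_univ (w : ℂ) :
    w * cauchyGauss Set.univ w = 1 - (Real.exp (-Real.pi * ‖w‖ ^ 2) : ℂ) := by
  rw [cauchyGauss, setIntegral_univ, ← integral_const_mul,
    ← Complex.integral_comp_polarCoord_symm]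
  have hint := integrableOn_polar ((integrable_gauss_div w).const_mul w) (by fun_prop)
  rw [polarCoord_target] at hint ⊢
  rw [Measure.volume_eq_prod] at hint ⊢
  rw [setIntegral_prod _ hint]
  have hin : ∀ r ∈ Set.Ioi (0 : ℝ), r ≠ ‖w‖ →
      (∫ θ in Set.Ioo (-Real.pi) Real.pi, (r, θ).1 •
        (w * ((Real.exp (-Real.pi * ‖Complex.polarCoord.symm (r, θ)‖ ^ 2) : ℂ) /
          (w - Complex.polarCoord.symm (r, θ))))) =
      ((Set.Iio ‖w‖).indicator (fun r => 2 * Real.pi * r * Real.exp (-Real.pi * r ^ 2)) r : ℝ) := by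
    intro r hr hrw
    have hr0 : 0 < r := hr
    have e : ∀ θ : ℝ, (r, θ).1 •
        (w * ((Real.exp (-Real.pi * ‖Complex.polarCoord.symm (r, θ)‖ ^ 2) : ℂ) /
          (w - Complex.polarCoord.symm (r, θ)))) =
        (r * Real.exp (-Real.pi * r ^ 2) : ℝ) * (w / (w - circleMap 0 r θ)) := by
      intro θ
      have : Complex.polarCoord.symm (r, θ) = circleMap 0 r θ := by
        rw [Complex.polarCoord_symm_apply, circleMap, zero_add, Complex.exp_mul_I]
        push_cast
        rfl
      rw [Complex.norm_polarCoord_symm, this]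
      simp only [sq_abs, Complex.real_smul]
      push_cast
      ring
    simp_rw [e]
    rw [integral_const_mul, setIntegral_angle_div_sub hr0 hrw]
    by_cases h : r < ‖w‖
    · rw [if_pos h, Set.indicator_of_mem (Set.mem_Iio.2 h)]
      push_cast
      ring
    · rw [if_neg h, Set.indicator_of_notMem (by simpa using h)]
      simp
  have hae : ∀ᵐ r : ℝ ∂(volume.restrict (Set.Ioi 0)),
      (∫ θ in Set.Ioo (-Real.pi) Real.pi, (r, θ).1 •
        (w * ((Real.exp (-Real.pi * ‖Complex.polarCoord.symm (r, θ)‖ ^ 2) : ℂ) /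
          (w - Complex.polarCoord.symm (r, θ))))) =
      ((Set.Iio ‖w‖).indicator (fun r => 2 * Real.pi * r * Real.exp (-Real.pi * r ^ 2)) r : ℝ) := by
    -- The circle through `w` is excluded as a single radius of measure zero.
    rw [ae_restrict_iff' measurableSet_Ioi]
    filter_upwards [compl_mem_ae_iff.2 (measure_singleton ‖w‖)] with r hr hr0
    exact hin r hr0 hr
  rw [integral_congr_ae hae, integral_complex_ofReal, integral_indicator measurableSet_Iio,
    Measure.restrict_restrict measurableSet_Iio, Set.Iio_inter_Ioi, ← integral_Ioc_eq_integral_Ioo,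
    ← intervalIntegral.integral_of_le (norm_nonneg w),
    intervalIntegral.integral_eq_sub_of_hasDerivAt
      (f := fun r : ℝ => -Real.exp (-Real.pi * r ^ 2)) (fun r _ => ?_)
      (Continuous.intervalIntegrable (by fun_prop) _ _)]
  · simp
    ring
  · have := (((hasDerivAt_id r).pow 2).const_mul (-Real.pi)).exp.neg
    refine this.congr_deriv ?_
    simp
    ring

/-! ### Boundary values and the shape of the domain -/

/-- A holomorphic function on a bounded domain with real boundary values is constant. -/
lemma exists_eqOn_closure_of_im_eq_zero {U : Set ℂ} (ho : IsOpen U) (hb : Bornology.IsBounded U)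
    (hc : IsPreconnected U) (hne : U.Nonempty) {H : ℂ → ℂ} (hd : DiffContOnCl ℂ H U)
    (him : ∀ z ∈ frontier U, (H z).im = 0) : ∃ c, ∀ z ∈ closure U, H z = c := by
  -- Maximum principle for `e^{-i a H}`, of modulus one on the boundary; the signs `a = ± 1` give
  -- `Im H = 0` inside.
  have bound : ∀ a : ℝ, ∀ z ∈ U, a * (H z).im ≤ 0 := by
    intro a z hz
    have hde : DiffContOnCl ℂ (fun z => Complex.exp (-a * Complex.I * H z)) U :=
      Complex.differentiable_exp.comp_diffContOnCl (hd.const_smul (-a * Complex.I))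
    have hn : ∀ z, ‖Complex.exp (-a * Complex.I * H z)‖ = Real.exp (a * (H z).im) := by
      intro z
      rw [Complex.norm_exp]
      congr 1
      simp
    have := Complex.norm_le_of_forall_mem_frontier_norm_le hb hde (C := 1) (fun w hw => by
      rw [hn, him w hw]
      simp) (subset_closure hz)
    rwa [hn, Real.exp_le_one_iff] at this
  have hzero : ∀ z ∈ U, (H z).im = 0 := by
    intro z hz
    have h1 := bound 1 z hz
    have h2 := bound (-1) z hz
    linarith
  have han : AnalyticOnNhd ℂ H U := hd.differentiableOn.analyticOnNhd ho
  obtain ⟨c, hcU⟩ : ∃ c, ∀ z ∈ U, H z = c := by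
    rcases han.is_constant_or_isOpen hc with h | h
    · exact h
    · exfalso
      obtain ⟨z, hz⟩ := hne
      obtain ⟨ε, hε, hball⟩ := Metric.isOpen_iff.1 (h U subset_rfl ho) (H z) ⟨z, hz, rfl⟩
      have hmem : H z + (ε / 2 : ℝ) * Complex.I ∈ Metric.ball (H z) ε := by
        rw [Metric.mem_ball, dist_eq_norm]
        simp [abs_of_pos hε]
        linarith
      obtain ⟨y, hy, hyz⟩ := hball hmem
      have h1 := congrArg Complex.im hyz
      rw [hzero y hy] at h1
      simp [hzero z hz] at h1
      linarith
  refine ⟨c, fun z hz => ?_⟩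
  have hEq : Set.EqOn H (fun _ => c) U := hcU
  exact hEq.of_subset_closure hd.continuousOn continuousOn_const subset_closure subset_rfl hz

/-- A bounded open set whose boundary lies on a circle centred at the origin is a disc. -/
lemma eq_ball_of_frontier {U : Set ℂ} (ho : IsOpen U) (hb : Bornology.IsBounded U)
    (hne : U.Nonempty) (hf : ∀ z ∈ frontier U, ∀ w ∈ frontier U, ‖z‖ = ‖w‖) :
    ∃ r : ℝ, 0 < r ∧ U = Metric.ball 0 r := by
  have hU : U ≠ Set.univ := by
    rintro rfl
    exact NormedSpace.unbounded_univ ℝ ℂ hb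
  obtain ⟨w₀, hw₀⟩ := nonempty_frontier_iff.2 ⟨hne, hU⟩
  -- A connected set that meets `U` and avoids the circle containing its boundary cannot leave `U`.
  have sub : ∀ s : Set ℂ, IsPreconnected s → (s ∩ U).Nonempty → (∀ z ∈ s, ‖z‖ ≠ ‖w₀‖) →
      s ⊆ U := by
    intro s hs h1 h2
    refine hs.subset_of_closure_inter_subset ho h1 fun y hy => ?_
    by_contra hyU
    have hyf : y ∈ frontier U := by
      rw [ho.frontier_eq]
      exact ⟨hy.1, hyU⟩
    exact h2 y hy.2 (hf y hyf w₀ hw₀)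
  have hle : U ⊆ Metric.closedBall 0 ‖w₀‖ := by
    intro z hz
    rw [mem_closedBall_zero_iff]
    by_contra! hlt
    have hz0 : 0 < ‖z‖ := (norm_nonneg _).trans_lt hlt
    -- A point of `U` outside the circle would drag its whole outward ray into the bounded set `U`.
    have hray := sub ((fun t : ℝ => (t : ℂ) * z) '' Set.Ici 1)
      (isPreconnected_Ici.image _ (by fun_prop))
      ⟨z, ⟨1, by simp, by simp⟩, hz⟩ (by
        rintro _ ⟨t, ht, rfl⟩
        have ht' : (1 : ℝ) ≤ t := ht
        simp only [norm_mul, Complex.norm_real]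
        rw [Real.norm_of_nonneg (by linarith)]
        nlinarith)
    obtain ⟨M, hM⟩ := isBounded_iff_forall_norm_le.1 hb
    have h := hM _ (hray ⟨max 1 ((M + 1) / ‖z‖), Set.mem_Ici.2 (le_max_left _ _), rfl⟩)
    simp only [norm_mul, Complex.norm_real] at h
    rw [Real.norm_of_nonneg (le_trans zero_le_one (le_max_left _ _))] at h
    have h2 : (M + 1) / ‖z‖ * ‖z‖ ≤ max 1 ((M + 1) / ‖z‖) * ‖z‖ := by
      gcongr
      exact le_max_right _ _
    rw [div_mul_cancel₀ _ hz0.ne'] at h2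
    linarith
  have hr : 0 < ‖w₀‖ := by
    by_contra! h
    have h0 : ‖w₀‖ = 0 := le_antisymm h (norm_nonneg _)
    rw [h0, Metric.closedBall_zero] at hle
    obtain ⟨z, hz⟩ := hne
    have hz0 : z = 0 := hle hz
    have hU0 : U = {0} := Set.Subset.antisymm hle (by
      rintro _ rfl
      rwa [← hz0])
    rw [hU0] at ho
    exact not_isOpen_singleton 0 ho
  have hsub : U ⊆ Metric.ball 0 ‖w₀‖ := by
    rw [← interior_closedBall _ hr.ne']
    exact interior_maximal hle ho
  refine ⟨‖w₀‖, hr, hsub.antisymm ?_⟩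
  refine sub _ (convex_ball 0 ‖w₀‖).isPreconnected ?_ fun z hz => ?_
  · obtain ⟨z, hz⟩ := hne
    exact ⟨z, hsub hz, hz⟩
  · exact (mem_ball_zero_iff.1 hz).ne

/-- If the Cauchy transform of the Gaussian measure on `Ω` coincides near infinity with that of a
point mass at the origin, then `Ω` is a disc. -/
lemma eq_ball_of_integral_eq_zero {Ω : Set ℂ} (ho : IsOpen Ω) (hb : Bornology.IsBounded Ω)
    (hc : IsConnected Ω) (hfr : frontier Ω = frontier (outerRegion Ω)) {R : ℝ}
    (hR : ∀ w : ℂ, R < ‖w‖ →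
      ∫ z in Ω, z / (w - z) * (Real.exp (-Real.pi * ‖z‖ ^ 2) : ℂ) = 0) :
    ∃ r : ℝ, 0 < r ∧ Ω = Metric.ball 0 r := by
  set m : ℝ := ∫ z in Ω, Real.exp (-Real.pi * ‖z‖ ^ 2) with hm
  set Ψ : ℂ → ℂ := fun w => w * cauchyGauss Ω w - m with hΨ
  set H : ℂ → ℂ := fun w => w * cauchyGauss Ωᶜ w with hH
  have hΨc : Continuous Ψ := (continuous_id.mul (continuous_cauchyGauss Ω)).sub continuous_const
  have hHc : Continuous H := continuous_id.mul (continuous_cauchyGauss Ωᶜ)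
  obtain ⟨M, hM⟩ := isBounded_iff_forall_norm_le.1 hb
  -- Uses `w / (w - z) - 1 = z / (w - z)`; the radius `M` keeps `w` off `Ω`.
  have hfar : ∀ w : ℂ, max R M < ‖w‖ → Ψ w = 0 := by
    intro w hw
    have hi : Integrable (fun z : ℂ => (Real.exp (-Real.pi * ‖z‖ ^ 2) : ℂ)) :=
      integrable_gauss_norm_sq.ofReal
    simp only [hΨ, hm]
    rw [cauchyGauss, ← integral_const_mul, ← integral_complex_ofReal,
      ← integral_sub ((integrable_gauss_div w).restrict.const_mul w) hi.restrict,
      ← hR w ((le_max_left _ _).trans_lt hw)]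
    refine setIntegral_congr_fun ho.measurableSet fun z hz => ?_
    have hne : w - z ≠ 0 := by
      intro h0
      rw [sub_eq_zero.1 h0] at hw
      exact absurd (hM z hz) (not_le.2 ((le_max_right _ _).trans_lt hw))
    field_simp
    ring
  have hΨd : DifferentiableOn ℂ Ψ (closure Ω)ᶜ := fun w hw =>
    ((differentiableAt_id.mul (differentiableAt_cauchyGauss ho.measurableSet hw)).sub_const
      _).differentiableWithinAt
  have houter : ∀ w ∈ outerRegion Ω, Ψ w = 0 := by
    rintro w ⟨hw, hunb⟩
    set V := connectedComponentIn (closure Ω)ᶜ w with hV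
    have hVsub : V ⊆ (closure Ω)ᶜ := connectedComponentIn_subset _ _
    have hVo : IsOpen V := isClosed_closure.isOpen_compl.connectedComponentIn
    obtain ⟨p, hpV, hp⟩ : ∃ p ∈ V, max R M < ‖p‖ := by
      by_contra! h
      exact hunb (isBounded_iff_forall_norm_le.2 ⟨_, h⟩)
    have han : AnalyticOnNhd ℂ Ψ V := (hΨd.mono hVsub).analyticOnNhd hVo
    refine han.eqOn_zero_of_preconnected_of_eventuallyEq_zero isPreconnected_connectedComponentIn
      hpV ?_ (mem_connectedComponentIn hw)
    filter_upwards [continuous_norm.continuousAt.eventually (lt_mem_nhds hp)] with y hy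
    exact hfar y hy
  -- Every boundary point of `Ω` is a limit of outer points, and `Ψ` is continuous on the whole
  -- plane.
  have hfront : ∀ w ∈ frontier Ω, Ψ w = 0 := by
    intro w hw
    rw [hfr] at hw
    exact closure_minimal (s := outerRegion Ω) (t := {w | Ψ w = 0}) houter
      (isClosed_eq hΨc continuous_const) (frontier_subset_closure hw)
  have hsum : ∀ w, Ψ w + H w = ((1 - m - Real.exp (-Real.pi * ‖w‖ ^ 2) : ℝ) : ℂ) := by
    intro w
    have h1 := mul_cauchyGauss_univ w
    have h2 : cauchyGauss Ω w + cauchyGauss Ωᶜ w = cauchyGauss Set.univ w := by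
      rw [cauchyGauss, cauchyGauss, cauchyGauss, setIntegral_univ]
      exact integral_add_compl ho.measurableSet (integrable_gauss_div w)
    simp only [hΨ, hH]
    push_cast at h1 ⊢
    rw [← h2] at h1
    linear_combination h1
  have hHd : DiffContOnCl ℂ H Ω := by
    refine ⟨fun w hw => ?_, hHc.continuousOn⟩
    refine (differentiableAt_id.mul
      (differentiableAt_cauchyGauss ho.measurableSet.compl ?_)).differentiableWithinAt
    rwa [ho.isClosed_compl.closure_eq, Set.notMem_compl_iff]
  have hHf : ∀ w ∈ frontier Ω, H w = ((1 - m - Real.exp (-Real.pi * ‖w‖ ^ 2) : ℝ) : ℂ) := by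
    intro w hw
    rw [← hsum, hfront w hw, zero_add]
  obtain ⟨c, hconst⟩ := exists_eqOn_closure_of_im_eq_zero ho hb hc.isPreconnected hc.nonempty hHd
    fun w hw => by rw [hHf w hw, Complex.ofReal_im]
  -- The boundary values of the constant function `H` depend injectively on `‖w‖`.
  refine eq_ball_of_frontier ho hb hc.nonempty fun z hz w hw => ?_
  have h := (hconst z (frontier_subset_closure hz)).trans
    (hconst w (frontier_subset_closure hw)).symm
  rw [hHf z hz, hHf w hw, Complex.ofReal_inj, sub_right_inj, Real.exp_eq_exp] at h
  have h2 : ‖z‖ ^ 2 = ‖w‖ ^ 2 := mul_left_cancel₀ (neg_ne_zero.2 Real.pi_ne_zero) h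
  exact (pow_left_inj₀ (norm_nonneg _) (norm_nonneg _) two_ne_zero).1 h2

/-! ### Conclusion for eigenfunctions -/

lemma IsEigenfunction.ae_expMoment_eq {Ω : Set ℂ} (hΩ : MeasurableSet Ω) {f : ℝ → ℂ}
    (he : IsEigenfunction Ω f) {c : ℂ}
    (hf : f =ᵐ[volume] fun t : ℝ => c * Complex.exp (-Real.pi * t ^ 2)) :
    ∃ μ : ℂ, ∀ᵐ t : ℝ, expMoment Ω 0 t = μ := by
  obtain ⟨-, hne, l, hl⟩ := he
  have hc : c ≠ 0 := by
    rintro rfl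
    refine hne (hf.trans (Eventually.of_forall fun t => ?_))
    simp
  set b : ℂ := (((2 : ℝ) ^ (1 / 4 : ℝ) : ℝ) : ℂ) ^ 2 * (1 / 2 : ℂ) ^ (1 / 2 : ℂ) with hb
  have hb0 : b ≠ 0 := by
    have h1 : (((2 : ℝ) ^ (1 / 4 : ℝ) : ℝ) : ℂ) ≠ 0 := by
      exact_mod_cast (Real.rpow_pos_of_pos two_pos _).ne'
    have h2 : ((1 / 2 : ℂ) ^ (1 / 2 : ℂ)) ≠ 0 := by simp [Complex.cpow_eq_zero_iff]
    exact mul_ne_zero (pow_ne_zero _ h1) h2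
  refine ⟨l / b, ?_⟩
  filter_upwards [hl, hf] with t h1 h2
  rw [locOp_gaussian hΩ hf, h2, ← hb] at h1
  have he0 : Complex.exp (-Real.pi * t ^ 2) ≠ 0 := Complex.exp_ne_zero _
  rw [eq_div_iff hb0]
  -- The Gaussian appears on both sides of the eigenvalue equation and cancels, leaving a constant.
  refine mul_right_cancel₀ (mul_ne_zero hc he0) ?_
  linear_combination h1

/-- A domain whose localization operator has an eigenfunction with bounded Bargmann transform is a
disc. -/
lemma IsEigenfunction.exists_eq_ball {Ω : Set ℂ} (ho : IsOpen Ω) (hb : Bornology.IsBounded Ω)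
    (hc : IsConnected Ω) (hfr : frontier Ω = frontier (outerRegion Ω)) {f : ℝ → ℂ}
    (he : IsEigenfunction Ω f) {C : ℝ} (hC : ∀ s, ‖bargmann f s‖ ≤ C) :
    ∃ (a : ℂ) (r : ℝ), 0 < r ∧ Ω = Metric.ball a r := by
  obtain ⟨c, hf⟩ := exists_ae_eq_gaussian_of_bargmann_bounded he.1 hC
  obtain ⟨μ, hμ⟩ := he.ae_expMoment_eq ho.measurableSet hf
  obtain ⟨M, hM⟩ := isBounded_iff_forall_norm_le.1 hb
  exact ⟨0, eq_ball_of_integral_eq_zero ho hb hc hfr (R := max M 0) fun w hw =>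
    integral_div_sub_eq_zero ho.measurableSet (le_max_right _ _)
      (fun z hz => (hM z hz).trans (le_max_left _ _))
      (fun n => expMoment_succ_eq_zero ho.measurableSet hb hμ n 0) hw⟩

/-- The decay controls the Bargmann transform off a compact set, and continuity controls it on that
set; the conjugation comes from the relation between the two transforms. -/
lemma bargmann_bounded_of_stft_isBigO {f : ℝ → ℂ} (hf : MemLp f 2 volume)
    (h : stft gaussianWindow f =O[cocompact ℂ]
      fun z : ℂ => Real.exp (-Real.pi * ‖z‖ ^ 2 / 2)) :
    ∃ C, ∀ s, ‖bargmann f s‖ ≤ C := by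
  obtain ⟨c, hc⟩ := h.bound
  set k : ℝ := (2 : ℝ) ^ (1 / 4 : ℝ)
  have hk : 0 < k := Real.rpow_pos_of_pos two_pos _
  obtain ⟨K, hK, hsub⟩ := mem_cocompact.1 hc
  obtain ⟨B, hB⟩ := (hK.image Complex.continuous_conj).exists_bound_of_continuousOn
    (differentiable_bargmann hf).continuous.continuousOn
  refine ⟨max B (c / k), fun s => ?_⟩
  by_cases hs : (starRingEnd ℂ) s ∈ K
  · exact (hB s ⟨_, hs, Complex.conj_conj s⟩).trans (le_max_left _ _)
  · refine le_trans ?_ (le_max_right _ _)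
    have h1 : ‖stft gaussianWindow f ((starRingEnd ℂ) s)‖ ≤ _ := hsub hs
    rw [norm_stft_gaussianWindow, Complex.conj_conj, Real.norm_of_nonneg (Real.exp_pos _).le] at h1
    rw [le_div_iff₀ hk, mul_comm]
    exact le_of_mul_le_mul_right h1 (Real.exp_pos _)

end GaborLocalization

theorem mainTheorem6 (Ω : Set ℂ) (hΩ_open : IsOpen Ω) (hΩ_bdd : Bornology.IsBounded Ω)
    (hΩ_sc : IsSimplyConnected Ω)
    (hΩ_frontier : frontier Ω = frontier (GaborLocalization.outerRegion Ω)) :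
    ((∃ f : ℝ → ℂ, GaborLocalization.IsEigenfunction Ω f ∧
        GaborLocalization.stft GaborLocalization.gaussianWindow f =O[cocompact ℂ]
          fun z : ℂ => Real.exp (-Real.pi * ‖z‖ ^ 2 / 2)) →
      ∃ (a : ℂ) (r : ℝ), 0 < r ∧ Ω = Metric.ball a r) ∧
    ((∃ f : ℝ → ℂ, GaborLocalization.IsEigenfunction Ω f ∧
        GaborLocalization.HasGaussianDecay f ∧ GaborLocalization.HasGaussianDecay (𝓕 f)) →
      ∃ (a : ℂ) (r : ℝ), 0 < r ∧ Ω = Metric.ball a r) := by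
  have hc : IsConnected Ω := hΩ_sc.isPathConnected.isConnected
  refine ⟨?_, ?_⟩
  · rintro ⟨f, he, hO⟩
    obtain ⟨C, hC⟩ := GaborLocalization.bargmann_bounded_of_stft_isBigO he.1 hO
    exact he.exists_eq_ball hΩ_open hΩ_bdd hc hΩ_frontier hC
  · rintro ⟨f, he, h1, h2⟩
    obtain ⟨C, hC⟩ := GaborLocalization.bargmann_bounded_of_hasGaussianDecay he.1 h1 h2
    exact he.exists_eq_ball hΩ_open hΩ_bdd hc hΩ_frontier hC
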